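/- All Hilbert spaces are finite-dimensional complex and nonzero, with fixed orthonormal bases. Let $\mathcal H_i=\mathcal H_i^A\otimes\mathcal H_i^B$ ($i=1,2$), $d_A=\dim\mathcal H_1^A$, $d_B=\dim\mathcal H_1^B$. Write $\|\cdot\|$ for the operator norm, $\|\cdot\|_1$ for the trace norm, $\Gamma=\mathrm T_A\otimes\mathcal I_B$ for partial transposition, $O^\Gamma=\Gamma(O)$, and $L^\Gamma=\Gamma\circ L\circ\Gamma$ for a linear map $L:\mathcal B(\mathcal H_1)\to\mathcal B(\mathcal H_2)$. Let $L^\dagger$ be the adjoint for the Hilbert–Schmidt inner product, and $\mathscr T(L)=\sum_{i,j}E_{ij}\otimes L(E_{ij})$ the Choi matrix, where $E_{ij}$ are the matrix units of $\mathcal B(\mathcal H_1)$ in the fixed product basis. For Hermiticity-preserving $L$, let $L_\pm=\mathscr T^{-1}(\mathscr T(L)^\pm)$, where $\mathscr T(L)^\pm\ge 0$ are the positive and negative parts of $\mathscr T(L)$ in its spectral decomposition; $\widetilde L_\pm$ denotes any pair of completely positive (CP) maps with $L=\widetilde L_+-\widetilde L_-$. The negativity and logarithmic negativity of a density operator $\rho$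 are $E_N(\rho)=(\|\rho^\Gamma\|_1-1)/2$ and $E_L(\rho)=\log\|\rho^\Gamma\|_1$. A deterministic operation is a CP trace-preserving map $S$; a probabilistic operation is a finite family of CP maps $S_i$ with $\sum_iS_i$ trace preserving; a sub-operation is a CP map $S_i$ with $S_i^\dagger(I)\le I$. For $E\in\{E_N,E_L\}$ and density operators $\rho$ on $\mathcal H_1$, the entangling capacity $\mathrm{EC}_E$ is, respectively, $$\sup_\rho\{E(S(\rho))-E(\rho)\},\qquad \sup_\rho\Big\{\sum_ip_iE\big(S_i(\rho)/p_i\big)-E(\rho)\Big\},\qquad \sup_{\rho:\,p_i>0}\{E(S_i(\rho)/p_i)-E(\rho)\},$$ with $p_i=\mathrm{tr}\,S_i(\rho)$ (outcomes with $p_i=0$ contribute $0$). With an ancilla $\mathcal H_a=\mathcal H_a^A\otimes\mathcal H_a^B$, each map is replaced by $\mathcal I_a\otimes S$ (resp. $\mathcal I_a\otimes S_i$), $\rho$ ranges over density operators on $\mathcal H_a\otimes\mathcal H_1$, and $E$ is taken between $\mathcal H_a^A\otimes\mathcal H_i^A$ and $\mathcal H_a^B\otimes\mathcal H_i^B$.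 Write $\mathrm{EC}_N,\mathrm{EC}_L$ for $E=E_N,E_L$. All upper bounds below hold without an ancilla and with any ancilla, for every choice of the decompositions $\widetilde{\,\cdot\,}_\pm$; the upper bounds for $\mathrm{EC}_N$ are for the supremum restricted to states $\rho$ with any given value of $\|\rho^\Gamma\|_1$. All lower bounds hold for $\mathrm{EC}$ aided by any ancilla with $\dim\mathcal H_a^A\ge d_A$ and $\dim\mathcal H_a^B\ge d_B$. 1. For a deterministic operation $S$, $$\frac{\|{S^\Gamma_-}^\dagger(I)\|_1}{d_Ad_B}\le\mathrm{EC}_N(S)\le\|\widetilde{S^\Gamma}_-^\dagger(I)\|\,\|\rho^\Gamma\|_1,$$ $$\log\Big(1+2\frac{\|{S^\Gamma_-}^\dagger(I)\|_1}{d_Ad_B}\Big)\le\mathrm{EC}_L(S)\le\log\big(1+2\|\widetilde{S^\Gamma}_-^\dagger(I)\|\big).$$ 2. For a probabilistic operation $S$ composed of sub-operations $S_i$, $$\sum_i\frac{\|{S_i^\Gamma}_-^\dagger(I)\|_1}{d_Ad_B}\le\mathrm{EC}_N(S)\le\Big\|\sum_i\widetilde{S_i^\Gamma}_-^\dagger(I)\Big\|\,\|\rho^\Gamma\|_1,$$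 $$\sum_i\frac{\mathrm{tr}\,\mathscr T(S_i)}{d_Ad_B}\log\frac{\|\mathscr T(S_i^\Gamma)\|_1}{\mathrm{tr}\,\mathscr T(S_i)}\le\mathrm{EC}_L(S)\le\log\Big(1+2\Big\|\sum_i\widetilde{S_i^\Gamma}_-^\dagger(I)\Big\|\Big)$$ (terms with $S_i=0$ are $0$). The same upper bounds hold for the deterministic operation $\sum_iS_i$. 3. For a sub-operation $S_i$ and every density operator $\rho$, with $E_N=E_N(\rho)$ and ${E_N}_i=E_N(S_i(\rho)/p_i)$ (the left side being $0$ if $p_i=0$), $$p_i{E_N}_i\le E_N\Big(\|\widetilde{S_i^\Gamma}_-^\dagger(I)\|+\|\widetilde{S_i^\Gamma}_+^\dagger(I)\|\Big)+\|\widetilde{S_i^\Gamma}_-^\dagger(I)\|.$$ If $S_i\ne0$, then $$\mathrm{EC}_N(S_i)\ge\frac{\mathrm{tr}\,{S_i^\Gamma}_-^\dagger(I)}{\mathrm{tr}\,S_i^\dagger(I)},\qquad \mathrm{EC}_L(S_i)\ge\log\Big(1+2\frac{\mathrm{tr}\,{S_i^\Gamma}_-^\dagger(I)}{\mathrm{tr}\,S_i^\dagger(I)}\Big),$$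 and, if moreover $\mathrm{tr}\,{S_i^\Gamma}_-^\dagger(I)\neq0$, $$\frac{\mathrm{tr}\,{S_i^\Gamma}_-^\dagger(I)}{\mathrm{tr}\,S_i^\dagger(I)}=\Big(\frac{\mathrm{tr}\,{S_i^\Gamma}_+^\dagger(I)}{\mathrm{tr}\,{S_i^\Gamma}_-^\dagger(I)}-1\Big)^{-1},$$ so that the lower bounds can be rewritten accordingly. The upper bounds are unchanged by an ancilla also in the sense that $\|(\mathcal I_a\otimes\widetilde{S^\Gamma}_\pm)^\dagger(I)\|=\|\widetilde{S^\Gamma}_\pm^\dagger(I)\|$, and likewise $\|\sum_i(\mathcal I_a\otimes\widetilde{S_i^\Gamma}_-)^\dagger(I)\|=\|\sum_i\widetilde{S_i^\Gamma}_-^\dagger(I)\|$. -/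

import Mathlib

open Matrix
open scoped Kronecker ComplexOrder

namespace EntCap

/-- Operators on the Hilbert space with orthonormal basis indexed by `n`. -/
abbrev Op (n : Type*) := Matrix n n ℂ

/-- Linear mappings from operators to operators, `𝓑(ℋ₁) → 𝓑(ℋ₂)`. -/
abbrev SuperOp (m n : Type*) := Op m →ₗ[ℂ] Op n

section Norms

variable {n : Type*} [Fintype n] [DecidableEq n]

/-- Trace norm `‖O‖₁ = tr |O|`, with `|O| = √(O† O)`. -/
noncomputable def traceNorm (O : Op n) : ℝ :=
  (cfc Real.sqrt (Oᴴ * O)).trace.re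

/-- Operator norm with respect to the Euclidean (Hilbert space) norm. -/
noncomputable def opNorm (O : Op n) : ℝ :=
  ‖Matrix.toEuclideanCLM (n := n) (𝕜 := ℂ) O‖

/-- Positive part `H⁺` in the spectral decomposition of a Hermitian operator `H`. -/
noncomputable def spectralPos (H : Op n) : Op n := cfc (fun x : ℝ => max x 0) H

/-- Negative part `H⁻` in the spectral decomposition of a Hermitian operator `H`,
so that `H = H⁺ - H⁻`. -/
noncomputable def spectralNeg (H : Op n) : Op n := cfc (fun x : ℝ => max (-x) 0) H

/-- Density operators. -/
def IsDensity (ρ : Op n) : Prop := ρ.PosSemidef ∧ ρ.trace = 1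

/-- The normalization `P / tr P`. -/
noncomputable def normalized (X : Op n) : Op n := (X.trace)⁻¹ • X

end Norms

section SuperOperators

variable {m n : Type*}

/-- `ℐ ⊗ L`, where `ℐ` is the identity mapping on operators on the space indexed by `k`. -/
def idTensor (k : Type*) (L : SuperOp m n) : SuperOp (k × m) (k × n) where
  toFun X := Matrix.of fun x y =>
    L (Matrix.of fun i j => X (x.1, i) (y.1, j)) x.2 y.2
  map_add' X Y := by
    ext x y
    have h : (Matrix.of fun i j => (X + Y) (x.1, i) (y.1, j) : Op m)
        = (Matrix.of fun i j => X (x.1, i) (y.1, j))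
          + Matrix.of fun i j => Y (x.1, i) (y.1, j) := rfl
    exact congrFun (congrFun ((congrArg L h).trans (map_add L _ _)) x.2) y.2
  map_smul' c X := by
    ext x y
    have h : (Matrix.of fun i j => (c • X) (x.1, i) (y.1, j) : Op m)
        = c • (Matrix.of fun i j => X (x.1, i) (y.1, j)) := rfl
    exact congrFun (congrFun ((congrArg L h).trans (map_smul L _ _)) x.2) y.2

/-- Complete positivity: `ℐ ⊗ L` is positive for every finite-dimensional identity mapping. -/
def IsCP [Fintype m] [Fintype n] (L : SuperOp m n) : Prop :=
  ∀ (k : ℕ) (X : Op (Fin k × m)), X.PosSemidef → (idTensor (Fin k) L X).PosSemidef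

/-- Trace preservation. -/
def IsTP [Fintype m] [Fintype n] (L : SuperOp m n) : Prop :=
  ∀ X : Op m, (L X).trace = X.trace

variable [DecidableEq m]

/-- The adjoint `L†` with respect to the Hilbert-Schmidt inner product
`(X|Y) = tr (X† Y)`; see `trace_adj`. -/
noncomputable def adj [Fintype n] (L : SuperOp m n) : SuperOp n m where
  toFun Y := Matrix.of fun i j => ((L (Matrix.single i j 1))ᴴ * Y).trace
  map_add' Y Z := by
    ext i j
    simp [Matrix.mul_add]
  map_smul' c Y := by
    ext i j
    simp

/-- The defining property of the adjoint, `(Y|L(X)) = (L†(Y)|X)`. -/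
theorem trace_adj [Fintype m] [Fintype n] (L : SuperOp m n) (X : Op m) (Y : Op n) :
    (Yᴴ * L X).trace = ((adj L Y)ᴴ * X).trace := by
  have h1 : ∀ i j, ((adj L Y)ᴴ) j i = (Yᴴ * L (Matrix.single i j 1)).trace := by
    intro i j
    rw [Matrix.conjTranspose_apply]
    change star (((L (Matrix.single i j 1))ᴴ * Y).trace) = _
    rw [← Matrix.trace_conjTranspose, Matrix.conjTranspose_mul, Matrix.conjTranspose_conjTranspose]
  have h2 : L X = ∑ i, ∑ j, X i j • L (Matrix.single i j 1) := by
    conv_lhs => rw [Matrix.matrix_eq_sum_single X]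
    simp only [map_sum]
    refine Finset.sum_congr rfl fun i _ => Finset.sum_congr rfl fun j _ => ?_
    rw [← map_smul, Matrix.smul_single, smul_eq_mul, mul_one]
  rw [h2]
  simp only [Matrix.mul_sum, Matrix.trace_sum, Matrix.mul_smul, Matrix.trace_smul, ← h1,
    smul_eq_mul]
  rw [Finset.sum_comm]
  simp only [Matrix.trace, Matrix.diag, Matrix.mul_apply]
  exact Finset.sum_congr rfl fun i _ => Finset.sum_congr rfl fun j _ => mul_comm _ _

/-- Choi isomorphism `𝒯(L) = ∑ i j, E_ij ⊗ L(E_ij)`. -/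
noncomputable def choi [Fintype m] (L : SuperOp m n) : Op (m × n) :=
  ∑ i : m, ∑ j : m, Matrix.single i j (1 : ℂ) ⊗ₖ L (Matrix.single i j 1)

/-- The inverse Choi isomorphism, `𝒯⁻¹(C)(O) = tr₁ [(Oᵀ ⊗ I) C]`. -/
noncomputable def choiInv [Fintype m] [Fintype n] [DecidableEq n] (C : Op (m × n)) :
    SuperOp m n where
  toFun O := Matrix.of fun k l => ∑ i : m, ((Oᵀ ⊗ₖ (1 : Op n)) * C) (i, k) (i, l)
  map_add' X Y := by
    ext k l
    simp [Matrix.add_kronecker, Matrix.add_mul, Finset.sum_add_distrib]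
  map_smul' c X := by
    ext k l
    simp [Matrix.smul_kronecker, Finset.mul_sum]

variable [Fintype m] [Fintype n] [DecidableEq n]

/-- The positive part `L₊ = 𝒯⁻¹(𝒯(L)⁺)`. -/
noncomputable def posMap (L : SuperOp m n) : SuperOp m n := choiInv (spectralPos (choi L))

/-- The negative part `L₋ = 𝒯⁻¹(𝒯(L)⁻)`. -/
noncomputable def negMap (L : SuperOp m n) : SuperOp m n := choiInv (spectralNeg (choi L))

/-- `Lp` and `Lm` form some decomposition of `L` as a difference of two CP mappings. -/
def IsCPDecomp (L Lp Lm : SuperOp m n) : Prop := IsCP Lp ∧ IsCP Lm ∧ L = Lp - Lm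

/-- Deterministic quantum operations: CPTP mappings. -/
def IsDeterministicOp (S : SuperOp m n) : Prop := IsCP S ∧ IsTP S

/-- Probabilistic quantum operations, composed of sub-operations `S i`. -/
def IsProbabilisticOp {ι : Type*} [Fintype ι] (S : ι → SuperOp m n) : Prop :=
  (∀ i, IsCP (S i)) ∧ IsTP (∑ i, S i)

/-- A single sub-operation: a CP mapping with `S†(I) ≤ I`. -/
def IsSubOp (S : SuperOp m n) : Prop := IsCP S ∧ (1 - adj S 1).PosSemidef

end SuperOperators

section Bipartite

variable {A B A₁ B₁ A₂ B₂ : Type*}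

/-- Partial transposition `Γ = T_A ⊗ ℐ_B` on operators. -/
def pt : SuperOp (A × B) (A × B) where
  toFun O := Matrix.of fun x y => O (y.1, x.2) (x.1, y.2)
  map_add' _ _ := rfl
  map_smul' _ _ := rfl

/-- Partial transpose `L^Γ = Γ ∘ L ∘ Γ` of a linear mapping. -/
def ptMap (L : SuperOp (A₁ × B₁) (A₂ × B₂)) : SuperOp (A₁ × B₁) (A₂ × B₂) :=
  pt ∘ₗ L ∘ₗ pt

/-- `ℐ_a ⊗ L` for an ancilla `ℋ_a = ℋ_a^A ⊗ ℋ_a^B` with bases indexed by `P` and `Q`.  The factors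
are arranged so that the two parties are `ℋ_a^A ⊗ ℋ^A` and `ℋ_a^B ⊗ ℋ^B`. -/
def withAncilla (P Q : Type*) (L : SuperOp (A₁ × B₁) (A₂ × B₂)) :
    SuperOp ((P × A₁) × (Q × B₁)) ((P × A₂) × (Q × B₂)) :=
  (Matrix.reindexLinearEquiv ℂ ℂ (Equiv.prodProdProdComm P Q A₂ B₂)
      (Equiv.prodProdProdComm P Q A₂ B₂)).toLinearMap
    ∘ₗ idTensor (P × Q) L
    ∘ₗ (Matrix.reindexLinearEquiv ℂ ℂ (Equiv.prodProdProdComm P A₁ Q B₁)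
      (Equiv.prodProdProdComm P A₁ Q B₁)).toLinearMap

variable [Fintype A] [DecidableEq A] [Fintype B] [DecidableEq B]
variable [Fintype A₁] [DecidableEq A₁] [Fintype B₁] [DecidableEq B₁]
variable [Fintype A₂] [DecidableEq A₂] [Fintype B₂] [DecidableEq B₂]

/-- Negativity `E_N(ρ) = (‖ρ^Γ‖₁ - 1) / 2`. -/
noncomputable def EN (ρ : Op (A × B)) : ℝ := (traceNorm (pt ρ) - 1) / 2

/-- Logarithmic negativity `E_L(ρ) = log ‖ρ^Γ‖₁`. -/
noncomputable def EL (ρ : Op (A × B)) : ℝ := Real.log (traceNorm (pt ρ))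

/-- Probability `tr S(ρ)` that the sub-operation `S` occurs in the state `ρ`. -/
noncomputable def prob (S : SuperOp (A₁ × B₁) (A₂ × B₂)) (ρ : Op (A₁ × B₁)) : ℝ :=
  (S ρ).trace.re

/-- All density operators. -/
def states (A B : Type*) [Fintype A] [Fintype B] [DecidableEq A] [DecidableEq B] :
    Set (Op (A × B)) :=
  {ρ | IsDensity ρ}

/-- The density operators `ρ` with a given value `t` of `‖ρ^Γ‖₁`. -/
def statesWith (A B : Type*) [Fintype A] [Fintype B] [DecidableEq A] [DecidableEq B] (t : ℝ) :
    Set (Op (A × B)) :=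
  {ρ | IsDensity ρ ∧ traceNorm (pt ρ) = t}

/-- The supremum over the states in `K` of the increase `E(S(ρ)) - E(ρ)`, where `E` is `E₁` before
and `E₂` after the operation. -/
noncomputable def capDet (E₁ : Op (A₁ × B₁) → ℝ) (E₂ : Op (A₂ × B₂) → ℝ)
    (K : Set (Op (A₁ × B₁))) (S : SuperOp (A₁ × B₁) (A₂ × B₂)) : EReal :=
  ⨆ ρ ∈ K, ((E₂ (S ρ) - E₁ ρ : ℝ) : EReal)

/-- The supremum over the states in `K` of the average increase `∑ pᵢ E(Sᵢ(ρ)/pᵢ) - E(ρ)`;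
outcomes of probability zero contribute zero. -/
noncomputable def capProb {ι : Type*} [Fintype ι] (E₁ : Op (A₁ × B₁) → ℝ)
    (E₂ : Op (A₂ × B₂) → ℝ) (K : Set (Op (A₁ × B₁)))
    (S : ι → SuperOp (A₁ × B₁) (A₂ × B₂)) : EReal :=
  ⨆ ρ ∈ K, (((∑ i, prob (S i) ρ * E₂ (normalized (S i ρ))) - E₁ ρ : ℝ) : EReal)

/-- The entangling capacity of a single sub-operation: the supremum of `E(S(ρ)/p) - E(ρ)` over
the density operators `ρ` for which the probability `p = tr S(ρ)` is positive. -/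
noncomputable def capSub (E₁ : Op (A₁ × B₁) → ℝ) (E₂ : Op (A₂ × B₂) → ℝ)
    (S : SuperOp (A₁ × B₁) (A₂ × B₂)) : EReal :=
  ⨆ ρ ∈ {ρ ∈ states A₁ B₁ | 0 < prob S ρ}, ((E₂ (normalized (S ρ)) - E₁ ρ : ℝ) : EReal)

/-- Entangling capacity of a deterministic operation with respect to negativity. -/
noncomputable def ECN (S : SuperOp (A₁ × B₁) (A₂ × B₂)) : EReal :=
  capDet EN EN (states A₁ B₁) S

/-- As `ECN`, maximized over the states with `‖ρ^Γ‖₁ = t` only. -/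
noncomputable def ECNAt (t : ℝ) (S : SuperOp (A₁ × B₁) (A₂ × B₂)) : EReal :=
  capDet EN EN (statesWith A₁ B₁ t) S

/-- Entangling capacity of a deterministic operation with respect to logarithmic negativity. -/
noncomputable def ECL (S : SuperOp (A₁ × B₁) (A₂ × B₂)) : EReal :=
  capDet EL EL (states A₁ B₁) S

/-- Average entangling capacity of a probabilistic operation with respect to negativity. -/
noncomputable def ECNProb {ι : Type*} [Fintype ι] (S : ι → SuperOp (A₁ × B₁) (A₂ × B₂)) :
    EReal :=
  capProb EN EN (states A₁ B₁) S

/-- As `ECNProb`, maximized over the states with `‖ρ^Γ‖₁ = t` only. -/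
noncomputable def ECNProbAt {ι : Type*} [Fintype ι] (t : ℝ)
    (S : ι → SuperOp (A₁ × B₁) (A₂ × B₂)) : EReal :=
  capProb EN EN (statesWith A₁ B₁ t) S

/-- Average entangling capacity of a probabilistic operation with respect to logarithmic
negativity. -/
noncomputable def ECLProb {ι : Type*} [Fintype ι] (S : ι → SuperOp (A₁ × B₁) (A₂ × B₂)) :
    EReal :=
  capProb EL EL (states A₁ B₁) S

/-- Entangling capacity of a single sub-operation with respect to negativity. -/
noncomputable def ECNSub (S : SuperOp (A₁ × B₁) (A₂ × B₂)) : EReal := capSub EN EN S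

/-- Entangling capacity of a single sub-operation with respect to logarithmic negativity. -/
noncomputable def ECLSub (S : SuperOp (A₁ × B₁) (A₂ × B₂)) : EReal := capSub EL EL S

end Bipartite

end EntCap

open EntCap

set_option linter.unusedSectionVars false

/-! Upper bounds. Put `σ = pt ρ` with spectral parts `σ = X - Y`, so that `‖σ‖₁ = tr (X + Y)`. If
`ptMap S = Lp - Lm` with positive parts, then `pt (S ρ) = (Lp X + Lm Y) - (Lp Y + Lm X)` is a
difference of positive operators, and its trace norm is at most `tr Lp (X + Y) + tr Lm (X + Y)`
(`traceNorm_sub_le`, `traceNorm_pt_map_le`). Partial transposition keeps the trace, so trace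
preservation of the total operation trades the `Lp` term for `tr (X + Y)` plus the `Lm` term. Since
`tr Lm Z` is the pairing of `Lm†(I)` with `Z`, the factor `1 + 2 ‖Lm†(I)‖` results
(`sum_traceNorm_pt_map_le`). All bounds for probabilistic and deterministic operations follow from
it; the averaged logarithm also uses concavity. A single sub-operation is not trace preserving, and
there the traces of `X` and `Y` are kept apart (`prob_mul_EN_le`).

Lower bounds. They are the exact gains at one state, in which each party's system is maximally
entangled with that party's own ancilla. This state is a product across the cut and is fixed by
`pt`, so its initial entanglement is zero. Up to an isometry and the factor `1 / (dA dB)`, the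
partially transposed output is the Choi matrix of `ptMap S` (`withAncilla_maxEntState`), whose trace
norm is `tr 𝒯(S)` plus twice the trace of its negative part.

Ancillas. `(ℐ ⊗ L)†(I) = I ⊗ L†(I)`, and `M ↦ I ⊗ M` is an injective star homomorphism, hence
isometric. -/

namespace EntCap

/-! ### Trace norm, spectral parts and operator norm -/

section Norms

variable {n : Type*} [Fintype n] [DecidableEq n]

theorem traceNorm_of_posSemidef {X : Op n} (hX : X.PosSemidef) : traceNorm X = X.trace.re := by
  have hs : IsSelfAdjoint X := hX.isHermitian
  have hsq : Xᴴ * X = cfc (fun x : ℝ => x * x) X := by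
    rw [cfc_mul (fun x : ℝ => x) (fun x : ℝ => x) X (by fun_prop) (by fun_prop), cfc_id' ℝ X,
      hX.isHermitian.eq]
  have hspec := (posSemidef_iff_isHermitian_and_spectrum_nonneg.1 hX).2
  have : cfc Real.sqrt (Xᴴ * X) = X := by
    rw [hsq, ← cfc_comp' Real.sqrt (fun x : ℝ => x * x) X (by fun_prop) (by fun_prop)]
    conv_rhs => rw [← cfc_id' ℝ X]
    refine cfc_congr fun x hx => ?_
    exact Real.sqrt_mul_self (Complex.zero_le_real.1 (hspec hx))
  rw [traceNorm, this]

theorem posSemidef_exists_eq_mul {X : Op n} (hX : X.PosSemidef) : ∃ B : Op n, X = Bᴴ * B := by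
  have hs : IsSelfAdjoint X := hX.isHermitian
  have hspec := (posSemidef_iff_isHermitian_and_spectrum_nonneg.1 hX).2
  refine ⟨cfc Real.sqrt X, ?_⟩
  have h1 : (cfc Real.sqrt X)ᴴ = cfc Real.sqrt X := (cfc_predicate Real.sqrt X : IsSelfAdjoint _)
  rw [h1, ← cfc_mul Real.sqrt Real.sqrt X (by fun_prop) (by fun_prop)]
  conv_lhs => rw [← cfc_id' ℝ X]
  refine cfc_congr fun x hx => ?_
  exact (Real.mul_self_sqrt (Complex.zero_le_real.1 (hspec hx))).symm

theorem cfc_posSemidef {f : ℝ → ℝ} (hf : ∀ x, 0 ≤ f x) (H : Op n) : (cfc f H).PosSemidef := by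
  open scoped MatrixOrder in
  exact nonneg_iff_posSemidef.1 (cfc_nonneg fun x _ => hf x)

theorem spectralPos_posSemidef (H : Op n) : (spectralPos H).PosSemidef :=
  cfc_posSemidef (fun _ => le_max_right _ _) H

theorem spectralNeg_posSemidef (H : Op n) : (spectralNeg H).PosSemidef :=
  cfc_posSemidef (fun _ => le_max_right _ _) H

theorem spectralPos_sub_spectralNeg {H : Op n} (hH : H.IsHermitian) :
    spectralPos H - spectralNeg H = H := by
  have hs : IsSelfAdjoint H := hH
  rw [spectralPos, spectralNeg, ← cfc_sub _ _ H (by fun_prop) (by fun_prop)]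
  conv_rhs => rw [← cfc_id' ℝ H]
  refine cfc_congr fun x _ => ?_
  rcases le_total 0 x with h | h <;> simp [h]

theorem spectralPos_mul_spectralNeg (H : Op n) : spectralPos H * spectralNeg H = 0 := by
  rw [spectralPos, spectralNeg, ← cfc_mul _ _ H (by fun_prop) (by fun_prop)]
  rw [show (fun x : ℝ => max x 0 * max (-x) 0) = fun _ => 0 from ?_, cfc_const_zero]
  funext x
  rcases le_total 0 x with h | h <;> simp [h]

/-- An orthogonal difference of positive operators has the sum of the traces as its trace norm. -/
theorem traceNorm_sub_of_mul_eq_zero {X Y : Op n} (hX : X.PosSemidef) (hY : Y.PosSemidef)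
    (hXY : X * Y = 0) : traceNorm (X - Y) = X.trace.re + Y.trace.re := by
  have hYX : Y * X = 0 := by
    have := congrArg conjTranspose hXY
    rwa [conjTranspose_mul, hX.isHermitian.eq, hY.isHermitian.eq, conjTranspose_zero] at this
  -- Without cross terms, `X - Y` and the positive operator `X + Y` have the same square, hence the
  -- same absolute value.
  have h : (X - Y)ᴴ * (X - Y) = (X + Y)ᴴ * (X + Y) := by
    rw [conjTranspose_sub, conjTranspose_add, hX.isHermitian.eq, hY.isHermitian.eq]
    simp [mul_add, add_mul, mul_sub, sub_mul, hXY, hYX]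
  rw [traceNorm, h]
  change traceNorm (X + Y) = _
  rw [traceNorm_of_posSemidef (hX.add hY), trace_add, Complex.add_re]

theorem traceNorm_eq_spectral {H : Op n} (hH : H.IsHermitian) :
    traceNorm H = (spectralPos H).trace.re + (spectralNeg H).trace.re := by
  conv_lhs => rw [← spectralPos_sub_spectralNeg hH]
  exact traceNorm_sub_of_mul_eq_zero (spectralPos_posSemidef H) (spectralNeg_posSemidef H)
    (spectralPos_mul_spectralNeg H)

theorem trace_re_eq_spectral {H : Op n} (hH : H.IsHermitian) :
    H.trace.re = (spectralPos H).trace.re - (spectralNeg H).trace.re := by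
  conv_lhs => rw [← spectralPos_sub_spectralNeg hH]
  simp

theorem trace_re_nonneg {X : Op n} (hX : X.PosSemidef) : 0 ≤ X.trace.re :=
  (Complex.le_def.1 hX.trace_nonneg).1

theorem trace_re_le_traceNorm {H : Op n} (hH : H.IsHermitian) : H.trace.re ≤ traceNorm H := by
  rw [traceNorm_eq_spectral hH, trace_re_eq_spectral hH]
  linarith [trace_re_nonneg (spectralNeg_posSemidef H)]

theorem trace_mul_re_nonneg {X Y : Op n} (hX : X.PosSemidef) (hY : Y.PosSemidef) :
    0 ≤ (X * Y).trace.re := by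
  obtain ⟨B, rfl⟩ := posSemidef_exists_eq_mul hY
  rw [← mul_assoc, trace_mul_comm, ← mul_assoc]
  exact trace_re_nonneg (hX.mul_mul_conjTranspose_same B)

/-- Any difference of positive operators bounds the trace norm by the sum of the traces. -/
theorem traceNorm_sub_le {X Y : Op n} (hX : X.PosSemidef) (hY : Y.PosSemidef) :
    traceNorm (X - Y) ≤ X.trace.re + Y.trace.re := by
  set H := X - Y with hHdef
  have hH : H.IsHermitian := hX.isHermitian.sub hY.isHermitian
  have hs : IsSelfAdjoint H := hH
  -- With `s` the sign function, `‖H‖₁ = tr (s(H) H)`. Since `-I ≤ s(H) ≤ I`, pairing `s(H)` with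
  -- `X` and with `-Y` gives at most `tr X` and `tr Y`.
  set s : ℝ → ℝ := fun x => if 0 ≤ x then 1 else -1 with hsdef
  -- The sign function jumps at zero, but every function is continuous on a finite spectrum.
  have hfin : (spectrum ℝ H).Finite := Matrix.finite_real_spectrum
  have hc : ∀ g : ℝ → ℝ, ContinuousOn g (spectrum ℝ H) := fun g => hfin.continuousOn g
  have habs : traceNorm H = (cfc s H * H).trace.re := by
    have : cfc s H * H = spectralPos H + spectralNeg H := by
      rw [spectralPos, spectralNeg, ← cfc_add H _ _ (hc _) (hc _)]
      conv_lhs => rw [show cfc s H * H = cfc s H * cfc (fun x : ℝ => x) H by rw [cfc_id' ℝ H],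
        ← cfc_mul _ _ H (hc _) (hc _)]
      refine cfc_congr fun x _ => ?_
      by_cases h : 0 ≤ x
      · simp [hsdef, h]
      · have h' : x ≤ 0 := le_of_not_ge h
        simp [hsdef, h, h']
    rw [this, traceNorm_eq_spectral hH, trace_add, Complex.add_re]
  have h1 : (1 - cfc s H).PosSemidef := by
    rw [← cfc_const_one ℝ H, ← cfc_sub _ _ H (hc _) (hc _)]
    refine cfc_posSemidef (fun x => ?_) H
    by_cases h : 0 ≤ x <;> simp [hsdef, h]
  have h2 : (1 + cfc s H).PosSemidef := by
    rw [← cfc_const_one ℝ H, ← cfc_add H _ _ (hc _) (hc _)]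
    refine cfc_posSemidef (fun x => ?_) H
    by_cases h : 0 ≤ x <;> simp [hsdef, h]
  have e1 := trace_mul_re_nonneg h1 hX
  have e2 := trace_mul_re_nonneg h2 hY
  rw [habs, hHdef, ← hHdef]
  rw [sub_mul, one_mul, trace_sub, Complex.sub_re] at e1
  rw [add_mul, one_mul, trace_add, Complex.add_re] at e2
  have e3 : (cfc s H * H).trace.re = (cfc s H * X).trace.re - (cfc s H * Y).trace.re := by
    conv_lhs => rw [hHdef, ← hHdef, mul_sub, trace_sub, Complex.sub_re]
  linarith

theorem traceNorm_smul {H : Op n} (hH : H.IsHermitian) {c : ℝ} (hc : 0 ≤ c) :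
    traceNorm ((c : ℂ) • H) = c * traceNorm H := by
  have hc' : (0 : ℂ) ≤ (c : ℂ) := by exact_mod_cast hc
  conv_lhs => rw [← spectralPos_sub_spectralNeg hH, smul_sub]
  rw [traceNorm_sub_of_mul_eq_zero ((spectralPos_posSemidef H).smul hc')
    ((spectralNeg_posSemidef H).smul hc'), traceNorm_eq_spectral hH]
  · simp [mul_add]
  · simp [spectralPos_mul_spectralNeg]

/-- Isometries preserve the trace norm. -/
theorem traceNorm_isometry_conj {m : Type*} [Fintype m] [DecidableEq m] {H : Op n}
    (hH : H.IsHermitian) {W : Matrix m n ℂ} (hW : Wᴴ * W = 1) :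
    traceNorm (W * H * Wᴴ) = traceNorm H := by
  have htr : ∀ X : Op n, (W * X * Wᴴ).trace = X.trace := fun X => by
    rw [trace_mul_comm, ← Matrix.mul_assoc, hW, Matrix.one_mul]
  -- Conjugation by `W` keeps the two parts positive and, because `Wᴴ * W = 1`, also orthogonal with
  -- unchanged traces.
  conv_lhs => rw [← spectralPos_sub_spectralNeg hH, Matrix.mul_sub, Matrix.sub_mul]
  rw [traceNorm_sub_of_mul_eq_zero ((spectralPos_posSemidef H).mul_mul_conjTranspose_same W)
    ((spectralNeg_posSemidef H).mul_mul_conjTranspose_same W), htr, htr, traceNorm_eq_spectral hH]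
  calc W * spectralPos H * Wᴴ * (W * spectralNeg H * Wᴴ)
      = W * (spectralPos H * (Wᴴ * W) * spectralNeg H) * Wᴴ := by simp only [Matrix.mul_assoc]
    _ = 0 := by
        rw [hW, mul_one, spectralPos_mul_spectralNeg, Matrix.mul_zero, Matrix.zero_mul]

theorem opNorm_nonneg (M : Op n) : 0 ≤ opNorm M := norm_nonneg _

theorem re_dotProduct_mulVec_le (M : Op n) (v : n → ℂ) :
    (star v ⬝ᵥ (M *ᵥ v)).re ≤ opNorm M * (star v ⬝ᵥ v).re := by
  set w : EuclideanSpace ℂ n := WithLp.toLp 2 v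
  have h1 : star v ⬝ᵥ (M *ᵥ v) = inner ℂ w (Matrix.toEuclideanCLM (n := n) (𝕜 := ℂ) M w) := by
    simp [w, EuclideanSpace.inner_eq_star_dotProduct, dotProduct_comm]
  have h2 : (star v ⬝ᵥ v).re = ‖w‖ * ‖w‖ := by
    have : star v ⬝ᵥ v = inner ℂ w w := by
      rw [EuclideanSpace.inner_eq_star_dotProduct]
      exact dotProduct_comm _ _
    rw [this]
    exact inner_self_eq_norm_mul_norm (𝕜 := ℂ) w
  rw [h1, h2]
  calc _ ≤ ‖inner ℂ w (Matrix.toEuclideanCLM (n := n) (𝕜 := ℂ) M w)‖ := Complex.re_le_norm _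
    _ ≤ ‖w‖ * ‖Matrix.toEuclideanCLM (n := n) (𝕜 := ℂ) M w‖ := norm_inner_le_norm _ _
    _ ≤ ‖w‖ * (opNorm M * ‖w‖) := by
        gcongr
        exact ContinuousLinearMap.le_opNorm _ _
    _ = _ := by ring

/-- Factoring `X = Bᴴ * B` turns the trace into a sum of quadratic forms of `M` at the columns of
`Bᴴ`, each bounded by Cauchy–Schwarz; `M` need not be Hermitian. -/
theorem trace_mul_re_le_opNorm (M : Op n) {X : Op n} (hX : X.PosSemidef) :
    (M * X).trace.re ≤ opNorm M * X.trace.re := by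
  obtain ⟨B, rfl⟩ := posSemidef_exists_eq_mul hX
  have h : ∀ N : Op n, (N * (Bᴴ * B)).trace = ∑ i, star (Bᴴ.col i) ⬝ᵥ (N *ᵥ Bᴴ.col i) := by
    intro N
    rw [← mul_assoc, trace_mul_comm, ← mul_assoc]
    simp only [trace, diag, mul_apply, dotProduct, mulVec, col, Finset.sum_mul, Finset.mul_sum]
    refine Finset.sum_congr rfl fun i _ => ?_
    rw [Finset.sum_comm]
    refine Finset.sum_congr rfl fun j _ => Finset.sum_congr rfl fun k _ => ?_
    simp [mul_assoc]
  rw [h M, show (Bᴴ * B).trace = (1 * (Bᴴ * B)).trace by rw [one_mul], h 1, Complex.re_sum,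
    Complex.re_sum, Finset.mul_sum]
  refine Finset.sum_le_sum fun i _ => ?_
  simpa using re_dotProduct_mulVec_le M (Bᴴ.col i)

end Norms

/-! ### Operator norm under star homomorphisms and adjoints -/

section Homs
open scoped Matrix.Norms.L2Operator

theorem opNorm_starHom {m n : Type*} [Fintype n] [DecidableEq n] [Fintype m] [DecidableEq m]
    (φ : Op m →⋆ₙₐ[ℂ] Op n) (hφ : Function.Injective φ) (M : Op m) : opNorm (φ M) = opNorm M := by
  have h : ‖φ M‖ = ‖M‖ := NonUnitalStarAlgHom.norm_map φ hφ M
  simpa only [opNorm, Matrix.cstar_norm_def] using h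

theorem opNorm_conjTranspose {n : Type*} [Fintype n] [DecidableEq n] (M : Op n) :
    opNorm Mᴴ = opNorm M := by
  have h : ‖Mᴴ‖ = ‖M‖ := Matrix.l2_opNorm_conjTranspose M
  simpa only [opNorm, Matrix.cstar_norm_def] using h

end Homs

/-! ### Positive maps and the trace of their outputs -/

section Positivity

variable {m n : Type*} [Fintype m] [DecidableEq m] [Fintype n] [DecidableEq n]

/-- Positive (not necessarily completely positive) mappings. -/
def IsPos (L : SuperOp m n) : Prop := ∀ X : Op m, X.PosSemidef → (L X).PosSemidef

/-- `IsCP` tests only the index types `Fin k`; relabelling the basis extends it to every finite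
ancilla. -/
theorem IsCP.idTensor_posSemidef {L : SuperOp m n} (hL : IsCP L) {k : Type*} [Fintype k]
    {X : Op (k × m)} (hX : X.PosSemidef) : (idTensor k L X).PosSemidef := by
  let e := Fintype.equivFin k
  have h := hL (Fintype.card k) _ (hX.submatrix (Prod.map e.symm id))
  have h2 := h.submatrix (Prod.map e (id : n → n))
  convert h2 using 1
  ext x y
  simp [idTensor]

theorem IsCP.isPos {L : SuperOp m n} (hL : IsCP L) : IsPos L := fun _ hX =>
  (hL 1 _ (hX.submatrix Prod.snd)).submatrix fun j => ((0 : Fin 1), j)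

theorem trace_eq_ofReal {X : Op n} (hX : X.PosSemidef) : X.trace = (X.trace.re : ℂ) :=
  Complex.eq_re_of_ofReal_le (r := 0) (by simpa using hX.trace_nonneg)

theorem trace_map_eq (L : SuperOp m n) (X : Op m) : (L X).trace = ((adj L 1)ᴴ * X).trace := by
  simpa using trace_adj L X 1

/-- The adjoints are added before the norm is taken, so the norm of the sum appears and not the
larger sum of the norms. -/
theorem sum_trace_map_le {ι : Type*} [Fintype ι] (L : ι → SuperOp m n) {X : Op m}
    (hX : X.PosSemidef) :
    ∑ i, (L i X).trace.re ≤ opNorm (∑ i, adj (L i) 1) * X.trace.re := by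
  have h : ∑ i, (L i X).trace.re = ((∑ i, adj (L i) 1)ᴴ * X).trace.re := by
    rw [conjTranspose_sum, Finset.sum_mul, trace_sum, Complex.re_sum]
    exact Finset.sum_congr rfl fun i _ => by rw [trace_map_eq]
  rw [h, ← opNorm_conjTranspose]
  exact trace_mul_re_le_opNorm _ hX

theorem trace_map_le (L : SuperOp m n) {X : Op m} (hX : X.PosSemidef) :
    (L X).trace.re ≤ opNorm (adj L 1) * X.trace.re := by
  simpa using sum_trace_map_le (fun _ : Unit => L) hX

theorem adj_sum {ι : Type*} [Fintype ι] (L : ι → SuperOp m n) (Y : Op n) :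
    adj (∑ i, L i) Y = ∑ i, adj (L i) Y := by
  ext i j
  simp [adj, Matrix.sum_apply, conjTranspose_sum, Finset.sum_mul, trace_sum]

theorem normalized_eq_smul {X : Op n} (hX : X.PosSemidef) :
    normalized X = ((X.trace.re⁻¹ : ℝ) : ℂ) • X := by
  rw [normalized, Complex.ofReal_inv, ← trace_eq_ofReal hX]

end Positivity

/-! ### Partial transposition and the central trace norm estimate -/

section PartialTranspose

variable {A B A₁ B₁ A₂ B₂ : Type*}

theorem pt_pt (X : Op (A × B)) : pt (pt X) = X := rfl

theorem pt_map (S : SuperOp (A₁ × B₁) (A₂ × B₂)) (X : Op (A₁ × B₁)) :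
    pt (S X) = ptMap S (pt X) := rfl

theorem trace_pt [Fintype A] [Fintype B] (X : Op (A × B)) : (pt X).trace = X.trace := rfl

theorem pt_isHermitian {X : Op (A × B)} (hX : X.IsHermitian) : (pt X).IsHermitian := by
  ext x y
  exact hX.apply _ _

variable [Fintype A] [DecidableEq A] [Fintype B] [DecidableEq B]
variable [Fintype A₁] [DecidableEq A₁] [Fintype B₁] [DecidableEq B₁]
variable [Fintype A₂] [DecidableEq A₂] [Fintype B₂] [DecidableEq B₂]

theorem one_le_traceNorm_pt {ρ : Op (A × B)} (hρ : IsDensity ρ) : 1 ≤ traceNorm (pt ρ) := by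
  have := trace_re_le_traceNorm (pt_isHermitian hρ.1.isHermitian)
  rwa [trace_pt, hρ.2, Complex.one_re] at this

theorem traceNorm_pt_normalized {X : Op (A × B)} (hX : X.PosSemidef) :
    traceNorm (pt (normalized X)) = traceNorm (pt X) / X.trace.re := by
  rw [normalized_eq_smul hX, map_smul, traceNorm_smul (pt_isHermitian hX.isHermitian)
    (inv_nonneg.2 (trace_re_nonneg hX)), div_eq_inv_mul]

theorem eq_zero_of_trace_re {X : Op (A × B)} (hX : X.PosSemidef) (h : X.trace.re = 0) :
    X = 0 := by
  apply hX.trace_eq_zero_iff.1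
  rw [trace_eq_ofReal hX, h, Complex.ofReal_zero]

theorem traceNorm_zero : traceNorm (0 : Op A) = 0 := by
  rw [traceNorm_of_posSemidef PosSemidef.zero]; simp

/-- The identity also covers probability zero: there `normalized X` is `0` and the value `-1/2` of
`EN` is multiplied by `0`. -/
theorem trace_mul_EN_normalized {X : Op (A × B)} (hX : X.PosSemidef) :
    X.trace.re * EN (normalized X) = (traceNorm (pt X) - X.trace.re) / 2 := by
  by_cases h : X.trace.re = 0
  · rw [eq_zero_of_trace_re hX h]; simp [traceNorm_zero]
  · rw [EN, traceNorm_pt_normalized hX]; field_simp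

/-- The trace norm of the partially transposed output is controlled by the two parts of a
decomposition, evaluated on the positive and negative parts of the partially transposed input. -/
theorem traceNorm_pt_map_le {S Lp Lm : SuperOp (A₁ × B₁) (A₂ × B₂)} (hp : IsPos Lp)
    (hm : IsPos Lm) (h : ptMap S = Lp - Lm) {ρ : Op (A₁ × B₁)} (hρ : ρ.IsHermitian) :
    traceNorm (pt (S ρ)) ≤ (Lp (spectralPos (pt ρ) + spectralNeg (pt ρ))).trace.re
      + (Lm (spectralPos (pt ρ) + spectralNeg (pt ρ))).trace.re := by
  have hσ := spectralPos_sub_spectralNeg (pt_isHermitian hρ)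
  have h1 := spectralPos_posSemidef (pt ρ)
  have h2 := spectralNeg_posSemidef (pt ρ)
  set X := spectralPos (pt ρ)
  set Y := spectralNeg (pt ρ)
  have e : pt (S ρ) = (Lp X + Lm Y) - (Lp Y + Lm X) := by
    rw [pt_map, h, ← hσ]
    simp only [LinearMap.sub_apply, map_sub]
    abel
  rw [e]
  refine (traceNorm_sub_le ((hp X h1).add (hm Y h2)) ((hp Y h2).add (hm X h1))).trans
    (le_of_eq ?_)
  simp only [map_add, trace_add, Complex.add_re]
  ring

theorem sum_traceNorm_pt_map_le {ι : Type*} [Fintype ι]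
    {S Lp Lm : ι → SuperOp (A₁ × B₁) (A₂ × B₂)} (hp : ∀ i, IsPos (Lp i))
    (hm : ∀ i, IsPos (Lm i)) (h : ∀ i, ptMap (S i) = Lp i - Lm i) (hS : IsTP (∑ i, S i))
    {ρ : Op (A₁ × B₁)} (hρ : ρ.IsHermitian) :
    ∑ i, traceNorm (pt (S i ρ)) ≤ (1 + 2 * opNorm (∑ i, adj (Lm i) 1)) * traceNorm (pt ρ) := by
  have h1 := spectralPos_posSemidef (pt ρ)
  have h2 := spectralNeg_posSemidef (pt ρ)
  have hN := traceNorm_eq_spectral (pt_isHermitian hρ)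
  set Z := spectralPos (pt ρ) + spectralNeg (pt ρ) with hZ
  have hZp : Z.PosSemidef := h1.add h2
  have hZt : Z.trace.re = traceNorm (pt ρ) := by rw [hN, hZ, trace_add, Complex.add_re]
  -- Trace preservation is applied to `pt Z`, where `Z` is the absolute value of `pt ρ`; transposing
  -- back shows that the maps `Lp i - Lm i` together preserve the trace of `Z`.
  have hsum : ∑ i, (Lp i Z).trace.re - ∑ i, (Lm i Z).trace.re = Z.trace.re := by
    have e := congrArg Complex.re (hS (pt Z))
    rw [trace_pt, LinearMap.sum_apply, trace_sum, Complex.re_sum] at e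
    rw [← e, ← Finset.sum_sub_distrib]
    refine Finset.sum_congr rfl fun i _ => ?_
    rw [← trace_pt (S i (pt Z)), pt_map, pt_pt, h i, LinearMap.sub_apply, trace_sub,
      Complex.sub_re]
  have hb := sum_trace_map_le Lm hZp
  calc ∑ i, traceNorm (pt (S i ρ))
      ≤ ∑ i, ((Lp i Z).trace.re + (Lm i Z).trace.re) :=
        Finset.sum_le_sum fun i _ => traceNorm_pt_map_le (hp i) (hm i) (h i) hρ
    _ = Z.trace.re + 2 * ∑ i, (Lm i Z).trace.re := by rw [Finset.sum_add_distrib]; linarith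
    _ ≤ _ := by rw [← hZt]; linarith

theorem traceNorm_pt_map_le_opNorm {S Lp Lm : SuperOp (A₁ × B₁) (A₂ × B₂)} (hp : IsPos Lp)
    (hm : IsPos Lm) (h : ptMap S = Lp - Lm) (hS : IsTP S) {ρ : Op (A₁ × B₁)}
    (hρ : ρ.IsHermitian) :
    traceNorm (pt (S ρ)) ≤ (1 + 2 * opNorm (adj Lm 1)) * traceNorm (pt ρ) := by
  simpa using sum_traceNorm_pt_map_le (ι := Unit) (S := fun _ => S) (Lp := fun _ => Lp)
    (Lm := fun _ => Lm) (fun _ => hp) (fun _ => hm) (fun _ => h) (by simpa using hS) hρ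

/-! ### From the trace norm estimate to capacities -/

theorem ECNAt_le {S : SuperOp (A₁ × B₁) (A₂ × B₂)} {c : ℝ}
    (h : ∀ ρ, IsDensity ρ → traceNorm (pt (S ρ)) ≤ (1 + 2 * c) * traceNorm (pt ρ)) (t : ℝ) :
    ECNAt t S ≤ ((c * t : ℝ) : EReal) := by
  refine iSup₂_le fun ρ hρ => EReal.coe_le_coe_iff.2 ?_
  have := h ρ hρ.1
  rw [EN, EN]
  rw [hρ.2] at this ⊢
  linarith

theorem ECL_le {S : SuperOp (A₁ × B₁) (A₂ × B₂)} (hS : IsPos S) (hT : IsTP S) {c : ℝ}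
    (hc : 0 ≤ c) (h : ∀ ρ, IsDensity ρ → traceNorm (pt (S ρ)) ≤ (1 + 2 * c) * traceNorm (pt ρ)) :
    ECL S ≤ ((Real.log (1 + 2 * c) : ℝ) : EReal) := by
  refine iSup₂_le fun ρ hρ => EReal.coe_le_coe_iff.2 ?_
  have h1 := one_le_traceNorm_pt hρ
  have h2 := one_le_traceNorm_pt (ρ := S ρ) ⟨hS ρ hρ.1, (hT ρ).trans hρ.2⟩
  have h3 := Real.log_le_log (by linarith) (h ρ hρ)
  rw [Real.log_mul (by linarith) (by linarith)] at h3
  rw [EL, EL]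
  linarith

theorem sum_prob {ι : Type*} [Fintype ι] {S : ι → SuperOp (A₁ × B₁) (A₂ × B₂)}
    (hT : IsTP (∑ i, S i)) {ρ : Op (A₁ × B₁)} (hρ : IsDensity ρ) : ∑ i, prob (S i) ρ = 1 := by
  have e := congrArg Complex.re (hT ρ)
  rwa [LinearMap.sum_apply, trace_sum, Complex.re_sum, hρ.2, Complex.one_re] at e

theorem ECNProbAt_le {ι : Type*} [Fintype ι] {S : ι → SuperOp (A₁ × B₁) (A₂ × B₂)}
    (hS : ∀ i, IsPos (S i)) (hT : IsTP (∑ i, S i)) {c : ℝ}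
    (h : ∀ ρ, IsDensity ρ →
      ∑ i, traceNorm (pt (S i ρ)) ≤ (1 + 2 * c) * traceNorm (pt ρ)) (t : ℝ) :
    ECNProbAt t S ≤ ((c * t : ℝ) : EReal) := by
  refine iSup₂_le fun ρ hρ => EReal.coe_le_coe_iff.2 ?_
  have h1 := h ρ hρ.1
  have h2 : ∑ i, prob (S i) ρ * EN (normalized (S i ρ))
      = (∑ i, traceNorm (pt (S i ρ)) - 1) / 2 := by
    rw [← sum_prob hT hρ.1, ← Finset.sum_sub_distrib, Finset.sum_div]
    exact Finset.sum_congr rfl fun i _ => trace_mul_EN_normalized (hS i ρ hρ.1.1)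
  rw [h2, EN, hρ.2]
  rw [hρ.2] at h1
  linarith

/-- The tangent bound `log x ≤ x - 1` at `x = ‖pt X‖₁ / (N tr X)`. This is Jensen's inequality one
term at a time, in a form that stays valid for outcomes of probability zero. -/
theorem prob_mul_EL_le {X : Op (A × B)} (hX : X.PosSemidef) {N : ℝ} (hN : 0 < N) :
    X.trace.re * EL (normalized X)
      ≤ X.trace.re * Real.log N + (traceNorm (pt X) / N - X.trace.re) := by
  have hT := trace_re_le_traceNorm (pt_isHermitian hX.isHermitian)
  rw [trace_pt] at hT
  rcases (trace_re_nonneg hX).eq_or_lt with h | h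
  · rw [← h] at hT ⊢
    have : 0 ≤ traceNorm (pt X) / N := div_nonneg hT hN.le
    linarith
  · have hX' : 0 < traceNorm (pt X) := h.trans_le hT
    rw [EL, traceNorm_pt_normalized hX]
    have e := Real.log_le_sub_one_of_pos (x := traceNorm (pt X) / X.trace.re / N) (by positivity)
    rw [Real.log_div (by positivity) hN.ne'] at e
    have e2 := mul_le_mul_of_nonneg_left e h.le
    have e3 : X.trace.re * (traceNorm (pt X) / X.trace.re / N - 1)
        = traceNorm (pt X) / N - X.trace.re := by field_simp
    linarith

theorem ECLProb_le {ι : Type*} [Fintype ι] {S : ι → SuperOp (A₁ × B₁) (A₂ × B₂)}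
    (hS : ∀ i, IsPos (S i)) (hT : IsTP (∑ i, S i)) {c : ℝ} (hc : 0 ≤ c)
    (h : ∀ ρ, IsDensity ρ →
      ∑ i, traceNorm (pt (S i ρ)) ≤ (1 + 2 * c) * traceNorm (pt ρ)) :
    ECLProb S ≤ ((Real.log (1 + 2 * c) : ℝ) : EReal) := by
  refine iSup₂_le fun ρ hρ => EReal.coe_le_coe_iff.2 ?_
  have h1 := h ρ hρ
  have h0 := one_le_traceNorm_pt hρ
  have hp := sum_prob hT hρ
  -- For this `N` the corrections `‖pt (S i ρ)‖₁ / N - p i` sum to `1 - 1 = 0`, which leaves `log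
  -- N`.
  set N := ∑ i, traceNorm (pt (S i ρ)) with hNdef
  have hN : 1 ≤ N := by
    rw [← hp]
    refine Finset.sum_le_sum fun i _ => ?_
    have := trace_re_le_traceNorm (pt_isHermitian (hS i ρ hρ.1).isHermitian)
    rwa [trace_pt] at this
  have h2 : ∑ i, prob (S i) ρ * EL (normalized (S i ρ)) ≤ Real.log N := by
    calc ∑ i, prob (S i) ρ * EL (normalized (S i ρ))
        ≤ ∑ i, (prob (S i) ρ * Real.log N
            + (traceNorm (pt (S i ρ)) / N - prob (S i) ρ)) :=
          Finset.sum_le_sum fun i _ => prob_mul_EL_le (hS i ρ hρ.1) (by linarith)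
      _ = Real.log N := by
          rw [Finset.sum_add_distrib, Finset.sum_sub_distrib, ← Finset.sum_mul, ← Finset.sum_div,
            hp, ← hNdef, div_self (by linarith)]
          ring
  have h3 := Real.log_le_log (by linarith) h1
  rw [Real.log_mul (by linarith) (by linarith)] at h3
  rw [EL]
  linarith

/-- Subtracting the probability from the trace norm bound cancels `tr Lp X` and `tr Lm Y`; half of
what is left is `tr Lp Y + tr Lm X`. -/
theorem prob_mul_EN_le {S Lp Lm : SuperOp (A₁ × B₁) (A₂ × B₂)} (hS : IsPos S) (hp : IsPos Lp)
    (hm : IsPos Lm) (h : ptMap S = Lp - Lm) {ρ : Op (A₁ × B₁)} (hρ : IsDensity ρ) :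
    prob S ρ * EN (normalized (S ρ))
      ≤ EN ρ * (opNorm (adj Lm 1) + opNorm (adj Lp 1)) + opNorm (adj Lm 1) := by
  have hH := pt_isHermitian hρ.1.isHermitian
  have h0 := traceNorm_pt_map_le hp hm h hρ.1.isHermitian
  have h1 := spectralPos_posSemidef (pt ρ)
  have h2 := spectralNeg_posSemidef (pt ρ)
  have hN := traceNorm_eq_spectral hH
  have hT := trace_re_eq_spectral hH
  rw [trace_pt, hρ.2, Complex.one_re] at hT
  have e : prob S ρ = (Lp (spectralPos (pt ρ))).trace.re - (Lp (spectralNeg (pt ρ))).trace.re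
      - ((Lm (spectralPos (pt ρ))).trace.re - (Lm (spectralNeg (pt ρ))).trace.re) := by
    rw [prob, ← trace_pt (S ρ), pt_map, h]
    conv_lhs => rw [← spectralPos_sub_spectralNeg hH]
    simp
  have h3 := trace_map_le Lp h2
  have h4 := trace_map_le Lm h1
  have h5 : prob S ρ * EN (normalized (S ρ)) = (traceNorm (pt (S ρ)) - prob S ρ) / 2 :=
    trace_mul_EN_normalized (hS ρ hρ.1)
  rw [h5]
  simp only [map_add, trace_add, Complex.add_re] at h0
  set X := spectralPos (pt ρ)
  set Y := spectralNeg (pt ρ)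
  -- The two traces have difference `1` and sum `‖pt ρ‖₁`, which determines them.
  have hY : Y.trace.re = EN ρ := by rw [EN]; linarith
  have hX : X.trace.re = EN ρ + 1 := by rw [EN]; linarith
  rw [hY] at h3
  rw [hX] at h4
  linarith

end PartialTranspose

/-! ### Extension by an ancilla -/

section Ancilla

variable {P Q A₁ B₁ A₂ B₂ ι : Type*}

theorem withAncilla_apply (L : SuperOp (A₁ × B₁) (A₂ × B₂)) (X : Op ((P × A₁) × (Q × B₁)))
    (x y : (P × A₂) × (Q × B₂)) :
    withAncilla P Q L X x y
      = L (X.submatrix (fun i => ((x.1.1, i.1), (x.2.1, i.2)))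
          (fun i => ((y.1.1, i.1), (y.2.1, i.2)))) (x.1.2, x.2.2) (y.1.2, y.2.2) := rfl

/-- The extended map leaves the ancilla alone, so the two transpositions of the ancilla's A factor
cancel. -/
theorem ptMap_withAncilla (L : SuperOp (A₁ × B₁) (A₂ × B₂)) :
    ptMap (withAncilla P Q L) = withAncilla P Q (ptMap L) := rfl

theorem withAncilla_sub (L M : SuperOp (A₁ × B₁) (A₂ × B₂)) :
    withAncilla P Q (L - M) = withAncilla P Q L - withAncilla P Q M := rfl

theorem withAncilla_sum [Fintype ι] (L : ι → SuperOp (A₁ × B₁) (A₂ × B₂)) :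
    withAncilla P Q (∑ i, L i) = ∑ i, withAncilla P Q (L i) := by
  ext X x y
  simp [withAncilla_apply, LinearMap.sum_apply, Matrix.sum_apply]

variable [Fintype P] [DecidableEq P] [Fintype Q] [DecidableEq Q]
variable [Fintype A₁] [DecidableEq A₁] [Fintype B₁] [DecidableEq B₁]
variable [Fintype A₂] [DecidableEq A₂] [Fintype B₂] [DecidableEq B₂]

theorem IsCP.withAncilla_isPos {L : SuperOp (A₁ × B₁) (A₂ × B₂)} (hL : IsCP L) :
    IsPos (withAncilla P Q L) := fun _ hX =>
  (hL.idTensor_posSemidef (hX.submatrix (Equiv.prodProdProdComm P A₁ Q B₁).symm)).submatrix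
    (Equiv.prodProdProdComm P Q A₂ B₂).symm

theorem trace_withAncilla (L : SuperOp (A₁ × B₁) (A₂ × B₂)) (X : Op ((P × A₁) × (Q × B₁))) :
    (withAncilla P Q L X).trace
      = ∑ p, ∑ q, (L (X.submatrix (fun i => ((p, i.1), (q, i.2)))
          (fun i => ((p, i.1), (q, i.2))))).trace := by
  simp only [trace, diag, withAncilla_apply, Fintype.sum_prod_type]
  refine Finset.sum_congr rfl fun p _ => ?_
  rw [Finset.sum_comm]

theorem IsTP.withAncilla {L : SuperOp (A₁ × B₁) (A₂ × B₂)} (hL : IsTP L) :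
    IsTP (withAncilla P Q L) := fun X => by
  rw [trace_withAncilla, Finset.sum_congr rfl fun p _ => Finset.sum_congr rfl fun q _ => hL _]
  simp only [trace, diag, submatrix_apply, Fintype.sum_prod_type]
  refine Finset.sum_congr rfl fun p _ => ?_
  rw [Finset.sum_comm]

/-- The embedding `M ↦ I_a ⊗ M`. -/
def ancillaHom (P Q A B : Type*) [Fintype P] [DecidableEq P] [Fintype Q] [DecidableEq Q]
    [Fintype A] [DecidableEq A] [Fintype B] [DecidableEq B] :
    Op (A × B) →⋆ₙₐ[ℂ] Op ((P × A) × (Q × B)) where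
  toFun M := ((1 : Op (P × Q)) ⊗ₖ M).submatrix (Equiv.prodProdProdComm P A Q B)
    (Equiv.prodProdProdComm P A Q B)
  map_smul' c M := by rw [kronecker_smul]; rfl
  map_zero' := by simp
  map_add' M N := by rw [kronecker_add]; rfl
  map_mul' M N := by
    rw [submatrix_mul_equiv, ← mul_kronecker_mul, one_mul]
  map_star' M := by
    simp only [star_eq_conjTranspose, conjTranspose_submatrix, conjTranspose_kronecker,
      conjTranspose_one]

theorem ancillaHom_apply {A B : Type*} [Fintype A] [DecidableEq A] [Fintype B] [DecidableEq B]
    (M : Op (A × B)) (x y : (P × A) × (Q × B)) :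
    ancillaHom P Q A B M x y
      = if x.1.1 = y.1.1 ∧ x.2.1 = y.2.1 then M (x.1.2, x.2.2) (y.1.2, y.2.2) else 0 := by
  change (1 : Op (P × Q)) (x.1.1, x.2.1) (y.1.1, y.2.1) * M (x.1.2, x.2.2) (y.1.2, y.2.2) = _
  rw [one_apply]
  simp [Prod.ext_iff]

theorem ancillaHom_injective [Nonempty P] [Nonempty Q] {A B : Type*} [Fintype A] [DecidableEq A]
    [Fintype B] [DecidableEq B] : Function.Injective (ancillaHom P Q A B) := fun M N h => by
  obtain ⟨p⟩ := ‹Nonempty P›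
  obtain ⟨q⟩ := ‹Nonempty Q›
  ext i j
  have := congrFun (congrFun h ((p, i.1), (q, i.2))) ((p, j.1), (q, j.2))
  simpa [ancillaHom_apply] using this

/-- The trace of the extended map only sees the diagonal ancilla blocks of its input, and a matrix
unit meets such a block only when its row and column carry the same ancilla indices. -/
theorem adj_withAncilla_one (L : SuperOp (A₁ × B₁) (A₂ × B₂)) :
    adj (withAncilla P Q L) 1 = ancillaHom P Q A₁ B₁ (adj L 1) := by
  ext x y
  rw [ancillaHom_apply]
  simp only [adj, LinearMap.coe_mk, AddHom.coe_mk, of_apply, mul_one, trace_conjTranspose,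
    trace_withAncilla]
  have h : ∀ p q, (single x y (1 : ℂ)).submatrix (fun i : A₁ × B₁ => ((p, i.1), (q, i.2)))
      (fun i => ((p, i.1), (q, i.2)))
      = if x.1.1 = p ∧ y.1.1 = p ∧ x.2.1 = q ∧ y.2.1 = q then
          single (x.1.2, x.2.2) (y.1.2, y.2.2) 1 else 0 := by
    intro p q
    ext i j
    obtain ⟨⟨x1, x2⟩, x3, x4⟩ := x
    obtain ⟨⟨y1, y2⟩, y3, y4⟩ := y
    obtain ⟨i1, i2⟩ := i
    obtain ⟨j1, j2⟩ := j
    split_ifs with hc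
    · obtain ⟨rfl, rfl, rfl, rfl⟩ := hc
      simp [single, Prod.ext_iff]
    · simp only [submatrix_apply, single, of_apply, Prod.mk.injEq, Matrix.zero_apply]
      rw [if_neg]
      dsimp only at hc
      tauto
  simp only [h]
  split_ifs with hc
  · obtain ⟨h1, h2⟩ := hc
    rw [Finset.sum_eq_single y.1.1, Finset.sum_eq_single y.2.1]
    · simp [h1, h2]
    · intro q _ hq
      rw [if_neg (fun hh => hq hh.2.2.2.symm)]; simp
    · simp
    · intro p _ hq
      refine Finset.sum_eq_zero fun q _ => ?_
      rw [if_neg (fun hh => hq hh.2.1.symm)]; simp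
    · simp
  · rw [Finset.sum_eq_zero, star_zero]
    intro p _
    refine Finset.sum_eq_zero fun q _ => ?_
    rw [if_neg, map_zero, trace_zero]
    rintro ⟨rfl, h1, rfl, h2⟩
    exact hc ⟨h1.symm, h2.symm⟩

theorem opNorm_sum_adj_withAncilla [Nonempty P] [Nonempty Q] [Fintype ι]
    (L : ι → SuperOp (A₁ × B₁) (A₂ × B₂)) :
    opNorm (∑ i, adj (withAncilla P Q (L i)) 1) = opNorm (∑ i, adj (L i) 1) := by
  simp only [adj_withAncilla_one]
  rw [← map_sum, opNorm_starHom _ ancillaHom_injective]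

theorem opNorm_adj_withAncilla [Nonempty P] [Nonempty Q] (L : SuperOp (A₁ × B₁) (A₂ × B₂)) :
    opNorm (adj (withAncilla P Q L) 1) = opNorm (adj L 1) := by
  rw [adj_withAncilla_one, opNorm_starHom _ ancillaHom_injective]

end Ancilla

/-! ### Choi matrices -/

section Choi

variable {m n : Type*} [Fintype m] [DecidableEq m] [Fintype n] [DecidableEq n]

theorem choi_apply (L : SuperOp m n) (x y : m × n) :
    choi L x y = L (single x.1 y.1 1) x.2 y.2 := by
  simp only [choi, Matrix.sum_apply, kroneckerMap_apply, single, of_apply, ite_mul, one_mul,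
    zero_mul]
  rw [Finset.sum_eq_single x.1, Finset.sum_eq_single y.1]
  · simp
  · intro j _ hj; simp [hj]
  · simp
  · intro i _ hi; simp [hi]
  · simp

theorem choiInv_single (C : Op (m × n)) (i j : m) (k l : n) :
    choiInv C (single i j 1) k l = C (i, k) (j, l) := by
  simp only [choiInv, LinearMap.coe_mk, AddHom.coe_mk, of_apply, mul_apply, kroneckerMap_apply,
    transpose_apply, Fintype.sum_prod_type, single, one_apply]
  rw [Finset.sum_eq_single j, Finset.sum_eq_single i, Finset.sum_eq_single k]
  · simp
  · intro b _ hb; simp [hb.symm]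
  · simp
  · intro b _ hb; simp [hb.symm]
  · simp
  · intro b _ hb; simp [hb.symm]
  · simp

/-- Up to entrywise conjugation, `L†(I)` is the partial trace of the Choi matrix over the output.
Hence traces and positivity pass from one to the other. -/
theorem adj_one_eq_of_choi (L : SuperOp m n) :
    adj L 1 = (∑ k, (choi L).submatrix (fun i => (i, k)) (fun i => (i, k)))ᴴᵀ := by
  ext i j
  simp [adj, trace, choi_apply, Matrix.sum_apply]

theorem choi_choiInv (C : Op (m × n)) : choi (choiInv C) = C := by
  ext x y
  rw [choi_apply, choiInv_single]

theorem trace_adj_one_re (L : SuperOp m n) : (adj L 1).trace.re = (choi L).trace.re := by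
  rw [adj_one_eq_of_choi, trace_transpose, trace_conjTranspose, trace_sum]
  simp only [trace, diag, submatrix_apply, Fintype.sum_prod_type, star_sum]
  rw [Finset.sum_comm]
  simp

theorem adj_one_posSemidef_of_choi {L : SuperOp m n} (h : (choi L).PosSemidef) :
    (adj L 1).PosSemidef := by
  rw [adj_one_eq_of_choi]
  exact (posSemidef_sum _ fun k _ => h.submatrix _).conjTranspose.transpose

theorem trace_adj_negMap_re (L : SuperOp m n) :
    (adj (negMap L) 1).trace.re = (spectralNeg (choi L)).trace.re := by
  rw [trace_adj_one_re, negMap, choi_choiInv]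

theorem trace_adj_posMap_re (L : SuperOp m n) :
    (adj (posMap L) 1).trace.re = (spectralPos (choi L)).trace.re := by
  rw [trace_adj_one_re, posMap, choi_choiInv]

theorem traceNorm_adj_negMap (L : SuperOp m n) :
    traceNorm (adj (negMap L) 1) = (spectralNeg (choi L)).trace.re := by
  rw [traceNorm_of_posSemidef, trace_adj_negMap_re]
  apply adj_one_posSemidef_of_choi
  rw [negMap, choi_choiInv]
  exact spectralNeg_posSemidef _

theorem choi_trace_eq (L : SuperOp m n) :
    (choi L).trace = ∑ i, (L (single i i 1)).trace := by
  simp only [trace, diag, choi_apply, Fintype.sum_prod_type]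

/-- The Choi matrix is the image under `ℐ ⊗ L` of the rank-one operator of the unnormalized
maximally entangled vector. -/
theorem IsCP.choi_posSemidef {L : SuperOp m n} (hL : IsCP L) : (choi L).PosSemidef := by
  have h := hL.idTensor_posSemidef
    (posSemidef_vecMulVec_self_star (fun x : m × m => if x.1 = x.2 then (1 : ℂ) else 0))
  convert h using 1
  ext x y
  rw [choi_apply]
  change _ = L _ x.2 y.2
  refine congrFun (congrFun (congrArg L ?_) _) _
  ext i j
  simp only [single, of_apply, vecMulVec_apply, Pi.star_apply]
  by_cases h1 : x.1 = i <;> by_cases h2 : y.1 = j <;> simp [h1, h2]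

theorem eq_zero_of_choi_eq_zero {L : SuperOp m n} (h : choi L = 0) : L = 0 := by
  refine Matrix.ext_linearMap ℂ fun i j => LinearMap.ext_ring ?_
  ext k l
  have := congrFun (congrFun h (i, k)) (j, l)
  rw [choi_apply] at this
  simpa [singleLinearMap] using this

end Choi

/-! ### Partial transposition of Choi matrices -/

section PartialTransposeChoi

variable {A₁ B₁ A₂ B₂ : Type*} [Fintype A₁] [DecidableEq A₁] [Fintype B₁] [DecidableEq B₁]
variable [Fintype A₂] [DecidableEq A₂] [Fintype B₂] [DecidableEq B₂]

theorem pt_single (i j : A₁ × B₁) :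
    pt (single i j (1 : ℂ)) = single (j.1, i.2) (i.1, j.2) 1 := by
  ext x y
  change (if i = (y.1, x.2) ∧ j = (x.1, y.2) then (1 : ℂ) else 0)
    = if (j.1, i.2) = x ∧ (i.1, j.2) = y then 1 else 0
  refine if_congr ?_ rfl rfl
  simp only [Prod.ext_iff]
  tauto

/-- On Choi matrices, `ptMap` is itself a partial transposition, over the input and output factors
of party A together. It therefore preserves Hermiticity and trace. -/
theorem choi_ptMap_apply (S : SuperOp (A₁ × B₁) (A₂ × B₂)) (x y : (A₁ × B₁) × (A₂ × B₂)) :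
    choi (ptMap S) x y = choi S ((y.1.1, x.1.2), (y.2.1, x.2.2)) ((x.1.1, y.1.2), (x.2.1, y.2.2))
    := by
  rw [choi_apply, choi_apply, ← pt_single]
  rfl

theorem choi_ptMap_isHermitian {S : SuperOp (A₁ × B₁) (A₂ × B₂)} (h : (choi S).IsHermitian) :
    (choi (ptMap S)).IsHermitian := by
  ext x y
  rw [conjTranspose_apply, choi_ptMap_apply, choi_ptMap_apply]
  exact h.apply _ _

theorem trace_choi_ptMap (S : SuperOp (A₁ × B₁) (A₂ × B₂)) :
    (choi (ptMap S)).trace = (choi S).trace := by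
  simp only [trace, diag, choi_ptMap_apply]

end PartialTransposeChoi

/-! ### Entrywise expansions for the test state -/

section Expansions

variable {X m n : Type*} [Fintype X] [DecidableEq X] [Fintype m] [DecidableEq m] [Fintype n]
  [DecidableEq n]

theorem map_rankOne_apply (L : SuperOp m n) (a b : m → ℂ) (k l : n) :
    L (of fun i j => a i * b j) k l = ∑ i, ∑ j, a i * b j * choi L (i, k) (j, l) := by
  conv_lhs => rw [matrix_eq_sum_single (of fun i j => a i * b j)]
  simp only [map_sum, Matrix.sum_apply]
  refine Finset.sum_congr rfl fun i _ => Finset.sum_congr rfl fun j _ => ?_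
  rw [choi_apply, ← smul_eq_mul, ← Matrix.smul_apply, ← map_smul, smul_single, of_apply,
    smul_eq_mul, mul_one]

theorem conj_apply_of_product (W : Matrix X (m × n) ℂ) (α : X → m → ℂ) (β : X → n)
    (hW : ∀ x i k, W x (i, k) = if β x = k then α x i else 0) (C : Op (m × n)) (x y : X) :
    (W * C * Wᴴ) x y = ∑ i, ∑ j, α x i * star (α y j) * C (i, β x) (j, β y) := by
  simp only [mul_apply, Fintype.sum_prod_type, hW, conjTranspose_apply, ite_mul, zero_mul,
    Finset.sum_ite_eq, Finset.mem_univ, if_true, apply_ite star, star_zero, mul_ite, mul_zero,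
    Finset.sum_mul]
  rw [Finset.sum_comm]
  exact Finset.sum_congr rfl fun i _ => Finset.sum_congr rfl fun j _ => by ring

end Expansions

/-! ### Lower bounds from the maximally entangled test state -/

section MaximallyEntangled

variable {P Q A₁ B₁ A₂ B₂ ι : Type*}
variable [Fintype P] [DecidableEq P] [Fintype Q] [DecidableEq Q]
variable [Fintype A₁] [DecidableEq A₁] [Fintype B₁] [DecidableEq B₁]
variable [Fintype A₂] [DecidableEq A₂] [Fintype B₂] [DecidableEq B₂]

/-- The indicator of the diagonal `x.1 = f x.2`. -/
def diagVec (f : A₁ → P) (x : P × A₁) : ℂ := if x.1 = f x.2 then 1 else 0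

/-- The state in which the ancilla and the system of either party are maximally entangled. -/
noncomputable def maxEntState (f : A₁ → P) (g : B₁ → Q) : Op ((P × A₁) × (Q × B₁)) :=
  (((Fintype.card A₁ * Fintype.card B₁ : ℝ)⁻¹ : ℝ) : ℂ) •
    of fun x y => diagVec f x.1 * diagVec g x.2 * (diagVec f y.1 * diagVec g y.2)

theorem star_diagVec (f : A₁ → P) (x : P × A₁) : star (diagVec f x) = diagVec f x := by
  unfold diagVec; split_ifs <;> simp

/-- The vector is real and a product between the parties, so transposing the A factor changes
nothing. -/
theorem pt_maxEntState (f : A₁ → P) (g : B₁ → Q) : pt (maxEntState f g) = maxEntState f g := by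
  ext x y
  change (_ : ℂ) • (diagVec f y.1 * diagVec g x.2 * (diagVec f x.1 * diagVec g y.2))
    = (_ : ℂ) • (diagVec f x.1 * diagVec g x.2 * (diagVec f y.1 * diagVec g y.2))
  congr 1
  ring

theorem sum_diagVec_mul_self (f : A₁ → P) :
    ∑ x, diagVec f x * diagVec f x = (Fintype.card A₁ : ℂ) := by
  rw [Fintype.sum_prod_type, Finset.sum_comm]
  simp [diagVec]

theorem maxEntState_isDensity [Nonempty A₁] [Nonempty B₁] (f : A₁ → P) (g : B₁ → Q) :
    IsDensity (maxEntState f g) := by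
  constructor
  · refine PosSemidef.smul ?_ (by exact_mod_cast inv_nonneg.2 (by positivity))
    convert posSemidef_vecMulVec_self_star
      (fun x : (P × A₁) × (Q × B₁) => diagVec f x.1 * diagVec g x.2) using 1
    ext x y
    simp [vecMulVec_apply, star_diagVec]
  · have h : ∑ x : (P × A₁) × (Q × B₁), diagVec f x.1 * diagVec g x.2 *
        (diagVec f x.1 * diagVec g x.2) = (Fintype.card A₁ : ℂ) * Fintype.card B₁ := by
      rw [Fintype.sum_prod_type, ← sum_diagVec_mul_self f, ← sum_diagVec_mul_self g,
        Finset.sum_mul_sum]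
      exact Finset.sum_congr rfl fun i _ => Finset.sum_congr rfl fun j _ => by ring
    rw [maxEntState, trace_smul]
    simp only [trace, diag, of_apply]
    rw [h]
    have h1 : (Fintype.card A₁ : ℂ) ≠ 0 := by exact_mod_cast Fintype.card_ne_zero
    have h2 : (Fintype.card B₁ : ℂ) ≠ 0 := by exact_mod_cast Fintype.card_ne_zero
    push_cast
    rw [smul_eq_mul]
    field_simp

theorem traceNorm_pt_maxEntState [Nonempty A₁] [Nonempty B₁] (f : A₁ → P) (g : B₁ → Q) :
    traceNorm (pt (maxEntState f g)) = 1 := by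
  have h := maxEntState_isDensity f g
  rw [pt_maxEntState, traceNorm_of_posSemidef h.1, h.2, Complex.one_re]

/-- The isometry that identifies the input copy in the Choi matrix with a part of the ancilla. -/
def ancillaIsometry (A₂ B₂ : Type*) [DecidableEq A₂] [DecidableEq B₂] (f : A₁ → P) (g : B₁ → Q) :
    Matrix ((P × A₂) × (Q × B₂)) ((A₁ × B₁) × (A₂ × B₂)) ℂ :=
  (1 : Op ((P × A₂) × (Q × B₂))).submatrix id
    fun u => ((f u.1.1, u.2.1), (g u.1.2, u.2.2))

theorem ancillaIsometry_isometry {f : A₁ → P} {g : B₁ → Q} (hf : Function.Injective f)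
    (hg : Function.Injective g) :
    (ancillaIsometry A₂ B₂ f g)ᴴ * ancillaIsometry A₂ B₂ f g = 1 := by
  rw [ancillaIsometry, conjTranspose_submatrix, conjTranspose_one,
    ← submatrix_mul _ _ _ id _ Function.bijective_id, one_mul]
  refine submatrix_one _ ?_
  rintro ⟨⟨a, b⟩, c, d⟩ ⟨⟨a', b'⟩, c', d'⟩ h
  simp only [Prod.mk.injEq] at h
  simp [hf h.1.1, hg h.2.1, h.1.2, h.2.2]

/-- This holds for any `f` and `g`; injectivity, which is where the ancilla dimensions enter, only
serves to make `ancillaIsometry` an isometry. -/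
theorem withAncilla_maxEntState (f : A₁ → P) (g : B₁ → Q)
    (L : SuperOp (A₁ × B₁) (A₂ × B₂)) :
    withAncilla P Q L (maxEntState f g) =
      (((Fintype.card A₁ * Fintype.card B₁ : ℝ)⁻¹ : ℝ) : ℂ) •
        (ancillaIsometry A₂ B₂ f g * choi L * (ancillaIsometry A₂ B₂ f g)ᴴ) := by
  rw [maxEntState, map_smul]
  congr 1
  ext x y
  rw [conj_apply_of_product _ (fun x i => diagVec f (x.1.1, i.1) * diagVec g (x.2.1, i.2))
    (fun x => (x.1.2, x.2.2)), withAncilla_apply]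
  · refine (map_rankOne_apply L (fun i => diagVec f (x.1.1, i.1) * diagVec g (x.2.1, i.2))
      (fun i => diagVec f (y.1.1, i.1) * diagVec g (y.2.1, i.2)) _ _).trans ?_
    refine Finset.sum_congr rfl fun i _ => Finset.sum_congr rfl fun j _ => ?_
    rw [star_mul', star_diagVec, star_diagVec]
  · intro x i k
    obtain ⟨⟨x1, x2⟩, x3, x4⟩ := x
    simp only [ancillaIsometry, submatrix_apply, one_apply, diagVec, id, Prod.ext_iff]
    by_cases h1 : x1 = f i.1 <;> by_cases h2 : x2 = k.1 <;> by_cases h3 : x3 = g i.2 <;>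
      by_cases h4 : x4 = k.2 <;> simp [h1, h2, h3, h4]

theorem traceNorm_pt_withAncilla_maxEntState {f : A₁ → P} {g : B₁ → Q}
    (hf : Function.Injective f) (hg : Function.Injective g)
    {S : SuperOp (A₁ × B₁) (A₂ × B₂)} (hS : IsCP S) :
    traceNorm (pt (withAncilla P Q S (maxEntState f g)))
      = traceNorm (choi (ptMap S)) / (Fintype.card A₁ * Fintype.card B₁) := by
  have h := choi_ptMap_isHermitian hS.choi_posSemidef.isHermitian
  rw [pt_map, pt_maxEntState, ptMap_withAncilla, withAncilla_maxEntState, traceNorm_smul,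
    traceNorm_isometry_conj h (ancillaIsometry_isometry hf hg), div_eq_inv_mul]
  · exact isHermitian_mul_mul_conjTranspose _ h
  · positivity

theorem prob_withAncilla_maxEntState {f : A₁ → P} {g : B₁ → Q}
    (hf : Function.Injective f) (hg : Function.Injective g) (S : SuperOp (A₁ × B₁) (A₂ × B₂)) :
    prob (withAncilla P Q S) (maxEntState f g)
      = (choi S).trace.re / (Fintype.card A₁ * Fintype.card B₁) := by
  rw [prob, withAncilla_maxEntState, trace_smul, trace_mul_comm, ← Matrix.mul_assoc,
    ancillaIsometry_isometry hf hg, Matrix.one_mul, smul_eq_mul, Complex.re_ofReal_mul,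
    div_eq_inv_mul]

theorem traceNorm_choi_ptMap {S : SuperOp (A₁ × B₁) (A₂ × B₂)} (hS : IsCP S) :
    traceNorm (choi (ptMap S))
      = (choi S).trace.re + 2 * (spectralNeg (choi (ptMap S))).trace.re := by
  have h := choi_ptMap_isHermitian hS.choi_posSemidef.isHermitian
  rw [traceNorm_eq_spectral h, ← trace_choi_ptMap, trace_re_eq_spectral h]
  ring

theorem IsTP.choi_trace {S : SuperOp (A₁ × B₁) (A₂ × B₂)} (hS : IsTP S) :
    (choi S).trace.re = Fintype.card A₁ * Fintype.card B₁ := by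
  rw [choi_trace_eq]
  simp [hS _]

theorem choi_trace_pos {S : SuperOp (A₁ × B₁) (A₂ × B₂)} (hS : IsCP S) (h0 : S ≠ 0) :
    0 < (choi S).trace.re := by
  refine (trace_re_nonneg hS.choi_posSemidef).lt_of_ne fun h => h0 ?_
  apply eq_zero_of_choi_eq_zero
  exact eq_zero_of_trace_re hS.choi_posSemidef h.symm

variable [Nonempty A₁] [Nonempty B₁]

theorem card_mul_card_pos (A B : Type*) [Fintype A] [Fintype B] [Nonempty A] [Nonempty B] :
    (0 : ℝ) < Fintype.card A * Fintype.card B := by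
  have h1 : (0 : ℝ) < Fintype.card A := by exact_mod_cast Fintype.card_pos
  have h2 : (0 : ℝ) < Fintype.card B := by exact_mod_cast Fintype.card_pos
  positivity

/-- The left side is exactly the gain at `maxEntState`; the same is true of the other lower bounds.
-/
theorem le_ECN {S : SuperOp (A₁ × B₁) (A₂ × B₂)} (hS : IsDeterministicOp S)
    (hP : Fintype.card A₁ ≤ Fintype.card P) (hQ : Fintype.card B₁ ≤ Fintype.card Q) :
    ((traceNorm (adj (negMap (ptMap S)) 1) / (Fintype.card A₁ * Fintype.card B₁) : ℝ) : EReal)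
      ≤ ECN (withAncilla P Q S) := by
  obtain ⟨f⟩ := Function.Embedding.nonempty_of_card_le hP
  obtain ⟨g⟩ := Function.Embedding.nonempty_of_card_le hQ
  refine le_iSup₂_of_le (maxEntState f g) (maxEntState_isDensity f g)
    (EReal.coe_le_coe_iff.2 (le_of_eq ?_))
  have := card_mul_card_pos A₁ B₁
  rw [EN, EN, traceNorm_pt_maxEntState, traceNorm_pt_withAncilla_maxEntState f.injective
    g.injective hS.1, traceNorm_choi_ptMap hS.1, hS.2.choi_trace, traceNorm_adj_negMap]
  field_simp
  ring

theorem le_ECL {S : SuperOp (A₁ × B₁) (A₂ × B₂)} (hS : IsDeterministicOp S)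
    (hP : Fintype.card A₁ ≤ Fintype.card P) (hQ : Fintype.card B₁ ≤ Fintype.card Q) :
    ((Real.log (1 + 2 * (traceNorm (adj (negMap (ptMap S)) 1) /
        (Fintype.card A₁ * Fintype.card B₁))) : ℝ) : EReal)
      ≤ ECL (withAncilla P Q S) := by
  obtain ⟨f⟩ := Function.Embedding.nonempty_of_card_le hP
  obtain ⟨g⟩ := Function.Embedding.nonempty_of_card_le hQ
  refine le_iSup₂_of_le (maxEntState f g) (maxEntState_isDensity f g)
    (EReal.coe_le_coe_iff.2 (le_of_eq ?_))
  have := card_mul_card_pos A₁ B₁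
  rw [EL, EL, traceNorm_pt_maxEntState, traceNorm_pt_withAncilla_maxEntState f.injective
    g.injective hS.1, traceNorm_choi_ptMap hS.1, hS.2.choi_trace, traceNorm_adj_negMap,
    Real.log_one, sub_zero]
  congr 1
  field_simp

theorem le_ECNProb [Fintype ι] {S : ι → SuperOp (A₁ × B₁) (A₂ × B₂)} (hS : ∀ i, IsCP (S i))
    (hP : Fintype.card A₁ ≤ Fintype.card P) (hQ : Fintype.card B₁ ≤ Fintype.card Q) :
    ((∑ i, traceNorm (adj (negMap (ptMap (S i))) 1) /
        (Fintype.card A₁ * Fintype.card B₁) : ℝ) : EReal)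
      ≤ ECNProb (fun i => withAncilla P Q (S i)) := by
  obtain ⟨f⟩ := Function.Embedding.nonempty_of_card_le hP
  obtain ⟨g⟩ := Function.Embedding.nonempty_of_card_le hQ
  have hρ := maxEntState_isDensity f g
  refine le_iSup₂_of_le (maxEntState f g) hρ (EReal.coe_le_coe_iff.2 (le_of_eq ?_))
  have := card_mul_card_pos A₁ B₁
  rw [EN, traceNorm_pt_maxEntState, sub_self, zero_div, sub_zero]
  refine Finset.sum_congr rfl fun i _ => ?_
  have h1 := trace_mul_EN_normalized ((hS i).withAncilla_isPos (P := P) (Q := Q) _ hρ.1)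
  have h2 := prob_withAncilla_maxEntState f.injective g.injective (S i)
  rw [prob] at h2 ⊢
  rw [h1, h2, traceNorm_pt_withAncilla_maxEntState f.injective g.injective (hS i),
    traceNorm_choi_ptMap (hS i), traceNorm_adj_negMap]
  field_simp
  ring

theorem le_ECLProb [Fintype ι] {S : ι → SuperOp (A₁ × B₁) (A₂ × B₂)} (hS : ∀ i, IsCP (S i))
    (hP : Fintype.card A₁ ≤ Fintype.card P) (hQ : Fintype.card B₁ ≤ Fintype.card Q) :
    ((∑ i, (choi (S i)).trace.re / (Fintype.card A₁ * Fintype.card B₁) *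
        Real.log (traceNorm (choi (ptMap (S i))) / (choi (S i)).trace.re) : ℝ) : EReal)
      ≤ ECLProb (fun i => withAncilla P Q (S i)) := by
  obtain ⟨f⟩ := Function.Embedding.nonempty_of_card_le hP
  obtain ⟨g⟩ := Function.Embedding.nonempty_of_card_le hQ
  have hρ := maxEntState_isDensity f g
  refine le_iSup₂_of_le (maxEntState f g) hρ (EReal.coe_le_coe_iff.2 (le_of_eq ?_))
  have := card_mul_card_pos A₁ B₁
  rw [EL, traceNorm_pt_maxEntState, Real.log_one, sub_zero]
  refine Finset.sum_congr rfl fun i _ => ?_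
  have h2 := prob_withAncilla_maxEntState f.injective g.injective (S i)
  rw [h2, EL, traceNorm_pt_normalized ((hS i).withAncilla_isPos (P := P) (Q := Q) _ hρ.1)]
  rw [prob] at h2
  -- Inside the logarithm the dimension factors cancel. No case split for `S i = 0` is needed, since
  -- both sides are then the same expression with prefactor `0`.
  rw [h2, traceNorm_pt_withAncilla_maxEntState f.injective g.injective (hS i),
    div_div_div_cancel_right₀ this.ne']

theorem le_ECSub {S : SuperOp (A₁ × B₁) (A₂ × B₂)} (hS : IsCP S) (h0 : S ≠ 0)
    (hP : Fintype.card A₁ ≤ Fintype.card P) (hQ : Fintype.card B₁ ≤ Fintype.card Q) :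
    (((adj (negMap (ptMap S)) 1).trace.re / (adj S 1).trace.re : ℝ) : EReal)
        ≤ ECNSub (withAncilla P Q S) ∧
      ((Real.log (1 + 2 * ((adj (negMap (ptMap S)) 1).trace.re / (adj S 1).trace.re)) : ℝ) :
          EReal) ≤ ECLSub (withAncilla P Q S) := by
  obtain ⟨f⟩ := Function.Embedding.nonempty_of_card_le hP
  obtain ⟨g⟩ := Function.Embedding.nonempty_of_card_le hQ
  have hρ := maxEntState_isDensity f g
  have hd := card_mul_card_pos A₁ B₁
  have hc := choi_trace_pos hS h0
  have h2 := prob_withAncilla_maxEntState f.injective g.injective S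
  have hp : 0 < prob (withAncilla P Q S) (maxEntState f g) := by rw [h2]; positivity
  have hN : traceNorm (pt (normalized (withAncilla P Q S (maxEntState f g))))
      = 1 + 2 * ((adj (negMap (ptMap S)) 1).trace.re / (adj S 1).trace.re) := by
    rw [prob] at h2
    rw [traceNorm_pt_normalized (hS.withAncilla_isPos _ hρ.1), h2,
      traceNorm_pt_withAncilla_maxEntState f.injective g.injective hS,
      div_div_div_cancel_right₀ hd.ne', traceNorm_choi_ptMap hS, trace_adj_negMap_re,
      trace_adj_one_re]
    field_simp
  constructor
  · refine le_iSup₂_of_le (maxEntState f g) ⟨hρ, hp⟩ (EReal.coe_le_coe_iff.2 (le_of_eq ?_))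
    rw [EN, EN, traceNorm_pt_maxEntState, hN]
    ring
  · refine le_iSup₂_of_le (maxEntState f g) ⟨hρ, hp⟩ (EReal.coe_le_coe_iff.2 (le_of_eq ?_))
    rw [EL, EL, traceNorm_pt_maxEntState, hN, Real.log_one, sub_zero]

/-- Partial transposition preserves the trace, so `tr S†(I)` is the difference of the traces of the
positive and negative parts. -/
theorem trace_negMap_div_eq {S : SuperOp (A₁ × B₁) (A₂ × B₂)} (hS : IsCP S)
    (h : (adj (negMap (ptMap S)) 1).trace.re ≠ 0) :
    (adj (negMap (ptMap S)) 1).trace.re / (adj S 1).trace.re =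
      ((adj (posMap (ptMap S)) 1).trace.re / (adj (negMap (ptMap S)) 1).trace.re - 1)⁻¹ := by
  have hH := choi_ptMap_isHermitian hS.choi_posSemidef.isHermitian
  rw [trace_adj_negMap_re] at h ⊢
  rw [trace_adj_posMap_re, trace_adj_one_re, ← trace_choi_ptMap, trace_re_eq_spectral hH,
    div_sub_one h, inv_div]

end MaximallyEntangled

/-! ### Upper bounds for deterministic operations, and sums of maps -/

section UpperBounds

variable {m n ι : Type*} [Fintype m] [Fintype n] [Fintype ι]

theorem IsCP.sum {L : ι → SuperOp m n} (hL : ∀ i, IsCP (L i)) : IsCP (∑ i, L i) :=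
  fun k X hX => by
  have h : idTensor (Fin k) (∑ i, L i) X = ∑ i, idTensor (Fin k) (L i) X := by
    ext x y
    simp [idTensor, Matrix.sum_apply]
  rw [h]
  exact posSemidef_sum _ fun i _ => hL i k X hX

theorem ptMap_sum {A₁ B₁ A₂ B₂ : Type*} (L : ι → SuperOp (A₁ × B₁) (A₂ × B₂)) :
    ptMap (∑ i, L i) = ∑ i, ptMap (L i) := by
  ext X : 1
  simp [ptMap, LinearMap.sum_apply, map_sum]

theorem deterministic_upper_bounds {P Q A₁ B₁ A₂ B₂ : Type*}
    [Fintype P] [DecidableEq P] [Nonempty P] [Fintype Q] [DecidableEq Q] [Nonempty Q]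
    [Fintype A₁] [DecidableEq A₁] [Fintype B₁] [DecidableEq B₁]
    [Fintype A₂] [DecidableEq A₂] [Fintype B₂] [DecidableEq B₂]
    {S Lp Lm : SuperOp (A₁ × B₁) (A₂ × B₂)} (hS : IsDeterministicOp S)
    (hL : IsCPDecomp (ptMap S) Lp Lm) :
    (∀ t : ℝ, ECNAt t S ≤ ((opNorm (adj Lm 1) * t : ℝ) : EReal)) ∧
      (∀ t : ℝ, ECNAt t (withAncilla P Q S) ≤ ((opNorm (adj Lm 1) * t : ℝ) : EReal)) ∧
      ECL S ≤ ((Real.log (1 + 2 * opNorm (adj Lm 1)) : ℝ) : EReal) ∧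
      ECL (withAncilla P Q S) ≤ ((Real.log (1 + 2 * opNorm (adj Lm 1)) : ℝ) : EReal) := by
  have hb := fun ρ (hρ : IsDensity ρ) =>
    traceNorm_pt_map_le_opNorm hL.1.isPos hL.2.1.isPos hL.2.2 hS.2 hρ.1.isHermitian
  have hba := fun ρ (hρ : IsDensity ρ) =>
    traceNorm_pt_map_le_opNorm (hL.1.withAncilla_isPos (P := P) (Q := Q))
      hL.2.1.withAncilla_isPos (S := withAncilla P Q S)
      (by rw [ptMap_withAncilla, hL.2.2, withAncilla_sub]) hS.2.withAncilla hρ.1.isHermitian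
  -- The estimate for the extended map now carries the norm of the original one.
  rw [opNorm_adj_withAncilla] at hba
  have hn := opNorm_nonneg (adj Lm 1)
  exact ⟨ECNAt_le hb, ECNAt_le hba, ECL_le hS.1.isPos hS.2 hn hb,
    ECL_le hS.1.withAncilla_isPos hS.2.withAncilla hn hba⟩

end UpperBounds

end EntCap

/-! ### Assembly of the three parts -/

theorem proposition1
    {P Q A₁ B₁ A₂ B₂ ι : Type*}
    [Fintype P] [DecidableEq P] [Nonempty P] [Fintype Q] [DecidableEq Q] [Nonempty Q]
    [Fintype A₁] [DecidableEq A₁] [Nonempty A₁] [Fintype B₁] [DecidableEq B₁] [Nonempty B₁]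
    [Fintype A₂] [DecidableEq A₂] [Fintype B₂] [DecidableEq B₂] [Fintype ι]
    (dA dB : ℝ) (hdA : dA = Fintype.card A₁) (hdB : dB = Fintype.card B₁) :
    -- part 1: deterministic operations
    (∀ S : SuperOp (A₁ × B₁) (A₂ × B₂), IsDeterministicOp S →
      -- lower bounds, with an ancilla at least as large as the input system
      (Fintype.card A₁ ≤ Fintype.card P → Fintype.card B₁ ≤ Fintype.card Q →
        ((traceNorm (adj (negMap (ptMap S)) 1) / (dA * dB) : ℝ) : EReal)
            ≤ ECN (withAncilla P Q S) ∧
        ((Real.log (1 + 2 * (traceNorm (adj (negMap (ptMap S)) 1) / (dA * dB))) : ℝ) : EReal)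
            ≤ ECL (withAncilla P Q S)) ∧
      -- upper bounds, without and with an arbitrary ancilla
      (∀ Lp Lm : SuperOp (A₁ × B₁) (A₂ × B₂), IsCPDecomp (ptMap S) Lp Lm →
        (∀ t : ℝ, ECNAt t S ≤ ((opNorm (adj Lm 1) * t : ℝ) : EReal)) ∧
        (∀ t : ℝ, ECNAt t (withAncilla P Q S) ≤ ((opNorm (adj Lm 1) * t : ℝ) : EReal)) ∧
        ECL S ≤ ((Real.log (1 + 2 * opNorm (adj Lm 1)) : ℝ) : EReal) ∧
        ECL (withAncilla P Q S) ≤ ((Real.log (1 + 2 * opNorm (adj Lm 1)) : ℝ) : EReal) ∧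
        opNorm (adj (withAncilla P Q Lm) 1) = opNorm (adj Lm 1))) ∧
    -- part 2: probabilistic operations
    (∀ S : ι → SuperOp (A₁ × B₁) (A₂ × B₂), IsProbabilisticOp S →
      (Fintype.card A₁ ≤ Fintype.card P → Fintype.card B₁ ≤ Fintype.card Q →
        ((∑ i, traceNorm (adj (negMap (ptMap (S i))) 1) / (dA * dB) : ℝ) : EReal)
            ≤ ECNProb (fun i => withAncilla P Q (S i)) ∧
        ((∑ i, (choi (S i)).trace.re / (dA * dB) *
              Real.log (traceNorm (choi (ptMap (S i))) / (choi (S i)).trace.re) : ℝ) : EReal)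
            ≤ ECLProb (fun i => withAncilla P Q (S i))) ∧
      (∀ Lp Lm : ι → SuperOp (A₁ × B₁) (A₂ × B₂),
        (∀ i, IsCPDecomp (ptMap (S i)) (Lp i) (Lm i)) →
        (∀ t : ℝ, ECNProbAt t S ≤ ((opNorm (∑ i, adj (Lm i) 1) * t : ℝ) : EReal)) ∧
        (∀ t : ℝ, ECNProbAt t (fun i => withAncilla P Q (S i))
            ≤ ((opNorm (∑ i, adj (Lm i) 1) * t : ℝ) : EReal)) ∧
        ECLProb S ≤ ((Real.log (1 + 2 * opNorm (∑ i, adj (Lm i) 1)) : ℝ) : EReal) ∧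
        ECLProb (fun i => withAncilla P Q (S i))
            ≤ ((Real.log (1 + 2 * opNorm (∑ i, adj (Lm i) 1)) : ℝ) : EReal) ∧
        -- the same upper bounds for the deterministic operation `∑ i, S i`
        (∀ t : ℝ, ECNAt t (∑ i, S i) ≤ ((opNorm (∑ i, adj (Lm i) 1) * t : ℝ) : EReal)) ∧
        (∀ t : ℝ, ECNAt t (withAncilla P Q (∑ i, S i))
            ≤ ((opNorm (∑ i, adj (Lm i) 1) * t : ℝ) : EReal)) ∧
        ECL (∑ i, S i) ≤ ((Real.log (1 + 2 * opNorm (∑ i, adj (Lm i) 1)) : ℝ) : EReal) ∧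
        ECL (withAncilla P Q (∑ i, S i))
            ≤ ((Real.log (1 + 2 * opNorm (∑ i, adj (Lm i) 1)) : ℝ) : EReal) ∧
        opNorm (∑ i, adj (withAncilla P Q (Lm i)) 1) = opNorm (∑ i, adj (Lm i) 1))) ∧
    -- part 3: a single sub-operation
    (∀ S : SuperOp (A₁ × B₁) (A₂ × B₂), IsSubOp S →
      (∀ Lp Lm : SuperOp (A₁ × B₁) (A₂ × B₂), IsCPDecomp (ptMap S) Lp Lm →
        (∀ ρ ∈ states A₁ B₁,
          prob S ρ * EN (normalized (S ρ))
            ≤ EN ρ * (opNorm (adj Lm 1) + opNorm (adj Lp 1)) + opNorm (adj Lm 1)) ∧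
        (∀ ρ ∈ states (P × A₁) (Q × B₁),
          prob (withAncilla P Q S) ρ * EN (normalized (withAncilla P Q S ρ))
            ≤ EN ρ * (opNorm (adj Lm 1) + opNorm (adj Lp 1)) + opNorm (adj Lm 1)) ∧
        opNorm (adj (withAncilla P Q Lm) 1) = opNorm (adj Lm 1) ∧
        opNorm (adj (withAncilla P Q Lp) 1) = opNorm (adj Lp 1)) ∧
      (S ≠ 0 → Fintype.card A₁ ≤ Fintype.card P → Fintype.card B₁ ≤ Fintype.card Q →
        (((adj (negMap (ptMap S)) 1).trace.re / (adj S 1).trace.re : ℝ) : EReal)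
            ≤ ECNSub (withAncilla P Q S) ∧
        ((Real.log (1 + 2 * ((adj (negMap (ptMap S)) 1).trace.re / (adj S 1).trace.re)) : ℝ) :
              EReal)
            ≤ ECLSub (withAncilla P Q S)) ∧
      -- the alternative form of these lower bounds, when the denominators do not vanish
      (S ≠ 0 → (adj (negMap (ptMap S)) 1).trace.re ≠ 0 →
        (adj (negMap (ptMap S)) 1).trace.re / (adj S 1).trace.re =
          ((adj (posMap (ptMap S)) 1).trace.re / (adj (negMap (ptMap S)) 1).trace.re - 1)⁻¹ ∧
        Real.log (1 + 2 * ((adj (negMap (ptMap S)) 1).trace.re / (adj S 1).trace.re)) =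
          Real.log (1 + 2 * ((adj (posMap (ptMap S)) 1).trace.re
              / (adj (negMap (ptMap S)) 1).trace.re - 1)⁻¹))) := by
  subst hdA hdB
  refine ⟨fun S hS => ⟨fun hP hQ => ⟨le_ECN hS hP hQ, le_ECL hS hP hQ⟩, fun Lp Lm hL => ?_⟩,
    fun S hS => ⟨fun hP hQ => ⟨le_ECNProb hS.1 hP hQ, le_ECLProb hS.1 hP hQ⟩,
      fun Lp Lm hL => ?_⟩,
    fun S hS => ⟨fun Lp Lm hL => ?_, fun h0 hP hQ => le_ECSub hS.1 h0 hP hQ, fun _ h => ?_⟩⟩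
  · obtain ⟨h1, h2, h3, h4⟩ := deterministic_upper_bounds (P := P) (Q := Q) hS hL
    exact ⟨h1, h2, h3, h4, opNorm_adj_withAncilla Lm⟩
  · have hp := fun i => (hL i).1.isPos
    have hm := fun i => (hL i).2.1.isPos
    have hpa := fun i => (hL i).1.withAncilla_isPos (P := P) (Q := Q)
    have hma := fun i => (hL i).2.1.withAncilla_isPos (P := P) (Q := Q)
    have hSa := fun i => (hS.1 i).withAncilla_isPos (P := P) (Q := Q)
    have ha : ∀ i, ptMap (withAncilla P Q (S i))
        = withAncilla P Q (Lp i) - withAncilla P Q (Lm i) := fun i => by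
      rw [ptMap_withAncilla, (hL i).2.2, withAncilla_sub]
    have hTa : IsTP (∑ i, withAncilla P Q (S i)) := by
      rw [← withAncilla_sum]; exact hS.2.withAncilla
    have hb := fun ρ (hρ : IsDensity ρ) =>
      sum_traceNorm_pt_map_le hp hm (fun i => (hL i).2.2) hS.2 hρ.1.isHermitian
    have hba := fun ρ (hρ : IsDensity ρ) =>
      sum_traceNorm_pt_map_le hpa hma ha hTa hρ.1.isHermitian
    rw [opNorm_sum_adj_withAncilla] at hba
    have hn := opNorm_nonneg (∑ i, adj (Lm i) 1)
    have hdet : IsDeterministicOp (∑ i, S i) := ⟨IsCP.sum hS.1, hS.2⟩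
    -- The sums of the given parts decompose the summed operation, so the deterministic bounds apply
    -- to it with the same norm.
    have hdec : IsCPDecomp (ptMap (∑ i, S i)) (∑ i, Lp i) (∑ i, Lm i) :=
      ⟨IsCP.sum fun i => (hL i).1, IsCP.sum fun i => (hL i).2.1, by
        rw [ptMap_sum, ← Finset.sum_sub_distrib]
        exact Finset.sum_congr rfl fun i _ => (hL i).2.2⟩
    have hd := deterministic_upper_bounds (P := P) (Q := Q) hdet hdec
    rw [adj_sum] at hd
    obtain ⟨h1, h2, h3, h4⟩ := hd
    exact ⟨ECNProbAt_le (fun i => (hS.1 i).isPos) hS.2 hb, ECNProbAt_le hSa hTa hba,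
      ECLProb_le (fun i => (hS.1 i).isPos) hS.2 hn hb, ECLProb_le hSa hTa hn hba, h1, h2, h3, h4,
      opNorm_sum_adj_withAncilla Lm⟩
  · refine ⟨fun ρ hρ => prob_mul_EN_le hS.1.isPos hL.1.isPos hL.2.1.isPos hL.2.2 hρ,
      fun ρ hρ => ?_, opNorm_adj_withAncilla Lm, opNorm_adj_withAncilla Lp⟩
    rw [← opNorm_adj_withAncilla (P := P) (Q := Q) Lm,
      ← opNorm_adj_withAncilla (P := P) (Q := Q) Lp]
    exact prob_mul_EN_le hS.1.withAncilla_isPos hL.1.withAncilla_isPos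
      hL.2.1.withAncilla_isPos (by rw [ptMap_withAncilla, hL.2.2, withAncilla_sub]) hρ
  · have e := trace_negMap_div_eq hS.1 h
    exact ⟨e, by rw [e]⟩
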